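/- **Theorem (liveness of FnF-BFT).** Consider the FnF-BFT protocol with $n=3f+1$ replicas, of which at most $f$ are byzantine, and any number of clients, any of which may be byzantine, in the partially synchronous model: messages between correct replicas, and requests from correct clients to correct replicas, are delivered after finite delays, and within $\Delta>0$ from an unknown global stabilization time (GST) on (a message sent at time $t$ arrives by $\max(t,\mathrm{GST})+\Delta$). Channels are authenticated, signatures and $(2f+1,n)$ threshold signatures are unforgeable, hash functions are ideal, and local computation takes no time. Byzantine replicas behave arbitrarily subject to this. In the protocol, every replica acts as a leader for the hash buckets assigned to it in the current epoch, with linear prepare and commit phases in which the leader collects $2f+1$ partial signatures, per-leader checkpoints every $k\ge 1$ requests and watermarks of width $2k$. A replica calls an epoch-change when all requests assigned in the epoch are committed locally, when its epoch timer $T$ expires, when the no-progress timers $T_p$ of $2f+1$ leaders have expired (they are first set $5\Delta$ after the start of the epoch), or when $f+1$ other replicas call for higher epochs (it then joins the smallest of these). The epoch-change timer, of default value $T_e$ and doubled after $f$ consecutive unsuccessful epoch-changes, starts upon $2f+1$ epoch-change messages for that epoch or a higher one; on its expiry the next epoch-change is called. The primary collects $2f+1$ epoch-change messages, reliably broadcasts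 the configuration determined by them (loads $C_v\ge C_{\min}\ge 1$, sequence numbers, hanging requests) and sends the new-epoch message. A leader proposes the oldest uncommitted, non-pending request of its active buckets, and always has at least one fresh sequence number per epoch. Upon entering an epoch a replica asks the others for missing commit-certificates. Primaries follow the performance-based rotation with sliding window $g\ge n$, computed from a common (otherwise arbitrary) record of primary performance. The $m\cdot n$ buckets, $m\ge1$, are shared among the leaders according to their loads and rotated so that, however the loads develop, each leader serves each bucket infinitely often under each of at least $f+1$ distinct primaries. There is an absolute constant $\kappa>0$ such that, if the timers are configured with $T,T_e,T_p\ge\kappa\Delta$, the following holds in every execution: if a correct client broadcasts a request $r$ (at any time), then every correct replica eventually commits $r$, i.e. from some point on it holds a commit-certificate for $r$. -/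

import Mathlib

namespace FnF

noncomputable section

open scoped Classical

/-! ### Parameters -/

/-- The configuration of the protocol for `n = 3f+1` replicas, indexed by `Fin n`.
`perf e` is the number of requests that the common record of the replicas credits to the primary of
epoch `e`; `rot e C b` is the leader that serves bucket `b` in epoch `e` when the loads are `C`. -/
structure Protocol (Client : Type*) where
  f : ℕ
  /-- there are `m * n` hash buckets -/
  m : ℕ
  /-- checkpoint period -/
  k : ℕ
  /-- minimal number of requests assigned to a leader -/
  Cmin : ℕ
  /-- length of the sliding window of the primary rotation -/
  g : ℕ
  /-- bound on the message delay after stabilization -/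
  Δ : ℝ
  /-- epoch timer -/
  T : ℝ
  /-- default value of the epoch-change timer -/
  Te : ℝ
  /-- no-progress timer -/
  Tp : ℝ
  hash : Client → Fin (m * (3 * f + 1))
  perf : ℕ → ℕ
  rot : ℕ → (Fin (3 * f + 1) → ℕ) → Fin (m * (3 * f + 1)) → Fin (3 * f + 1)

/-! ### Primary rotation -/

/-- State of the primary rotation before an epoch: the last turn of each replica (`0` if none), and
the replicas of the current cycle that are still to be elected. -/
structure RotState (f : ℕ) where
  last : Fin (3 * f + 1) → ℕ
  rest : List (Fin (3 * f + 1))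

/-- The `2f+1` replicas with the best performance in their last turn (ties broken by identifier),
ordered by the time passed since that turn, longest first. -/
def bestPrimaries (f : ℕ) (perf : ℕ → ℕ) (s : RotState f) : List (Fin (3 * f + 1)) :=
  (((List.finRange (3 * f + 1)).mergeSort
      (fun u w => decide (perf (s.last w) ≤ perf (s.last u)))).take (2 * f + 1)).mergeSort
    (fun u w => decide (s.last u ≤ s.last w))

/-- The primary elected for epoch `e` and the remaining cycle.  The first `n` epochs explore the
replicas in the order of their identifiers.  Later, a replica whose last turn was in epoch `e - g` is
re-explored; otherwise the next one of the current cycle of best primaries is taken, a new cycle being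
determined when the old one is exhausted. -/
def elect (f g : ℕ) (perf : ℕ → ℕ) (e : ℕ) (s : RotState f) :
    Fin (3 * f + 1) × List (Fin (3 * f + 1)) :=
  if e ≤ 3 * f + 1 then (Fin.ofNat (3 * f + 1) (e - 1), [])
  else
    match (List.finRange (3 * f + 1)).find? (fun u => decide (s.last u + g = e)) with
    | some u => (u, s.rest)
    | none =>
      match (if s.rest = [] then bestPrimaries f perf s else s.rest) with
      | [] => (0, [])
      | u :: l => (u, l)

/-- State of the rotation before epoch `e + 1`; epochs are numbered from `1`. -/
def rotState (f g : ℕ) (perf : ℕ → ℕ) : ℕ → RotState f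
  | 0 => ⟨fun _ => 0, []⟩
  | e + 1 =>
    let s := rotState f g perf e
    let p := elect f g perf (e + 1) s
    ⟨Function.update s.last p.1 (e + 1), p.2⟩

/-- The primary of epoch `e`. -/
def primaryOf (f g : ℕ) (perf : ℕ → ℕ) (e : ℕ) : Fin (3 * f + 1) :=
  (elect f g perf e (rotState f g perf (e - 1))).1

/-! ### Bucket rotation -/

/-- `⌊C_v / ∑ C_u · (m-1) n⌋ + 1`. -/
def baseBuckets (f m : ℕ) (C : Fin (3 * f + 1) → ℕ) (v : Fin (3 * f + 1)) : ℕ :=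
  ⌊(C v : ℚ) / (∑ u, C u : ℕ) * (((m - 1) * (3 * f + 1) : ℕ) : ℚ)⌋₊ + 1

/-- The value by which the remaining buckets are handed out. -/
def bucketScore (f m : ℕ) (C : Fin (3 * f + 1) → ℕ) (v : Fin (3 * f + 1)) : ℚ :=
  (baseBuckets f m C v : ℚ) - (C v : ℚ) / (∑ u, C u : ℕ) * ((m * (3 * f + 1) : ℕ) : ℚ)

/-- `rot` is a bucket rotation for the sequence `p` of primaries: leader `v` gets
`baseBuckets v + δ_v` of the `m n` buckets with `δ_v ∈ {0,1}`, those with `δ_v = 1` being leaders of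
biggest score; and, however the loads develop, each leader repeatedly (that is, infinitely often)
serves each bucket under each of `f + 1` distinct primaries. -/
structure IsBucketRotation (f m : ℕ) (p : ℕ → Fin (3 * f + 1))
    (rot : ℕ → (Fin (3 * f + 1) → ℕ) → Fin (m * (3 * f + 1)) → Fin (3 * f + 1)) : Prop where
  shares : ∀ (e : ℕ) (C : Fin (3 * f + 1) → ℕ), (∀ v, 1 ≤ C v) →
    ∃ R : Finset (Fin (3 * f + 1)),
      (∀ v, (Finset.univ.filter (fun b => rot e C b = v)).card =
        baseBuckets f m C v + if v ∈ R then 1 else 0) ∧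
      ∀ u ∈ R, ∀ w ∉ R, bucketScore f m C w ≤ bucketScore f m C u
  rotates : ∀ C : ℕ → Fin (3 * f + 1) → ℕ, (∀ e v, 1 ≤ C e v) → ∀ v b,
    ∃ S : Finset (Fin (3 * f + 1)), f + 1 ≤ S.card ∧
      ∀ q ∈ S, ∃ᶠ e in Filter.atTop, p e = q ∧ rot e (C e) b = v

/-! Bucket rotations exist, whatever the performance of the primaries. -/

theorem rotState_succ (f g : ℕ) (perf : ℕ → ℕ) (e : ℕ) :
    (rotState f g perf (e + 1)).last =
      Function.update (rotState f g perf e).last (primaryOf f g perf (e + 1)) (e + 1) := rfl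

theorem primaryOf_last (f g : ℕ) (perf : ℕ → ℕ) (e : ℕ) (u : Fin (3 * f + 1)) :
    (rotState f g perf e).last u ≤ e ∧ ((rotState f g perf e).last u ≠ 0 →
      primaryOf f g perf ((rotState f g perf e).last u) = u) := by
  induction e with
  | zero => simp [rotState]
  | succ e ih =>
    rw [rotState_succ]
    by_cases h : u = primaryOf f g perf (e + 1)
    · rw [h]; simp
    · rw [Function.update_of_ne h]
      exact ⟨ih.1.trans (Nat.le_succ e), ih.2⟩

theorem last_initial (f g : ℕ) (perf : ℕ → ℕ) (e : ℕ) (he : e ≤ 3 * f + 1) (u : Fin (3 * f + 1)) :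
    (rotState f g perf e).last u = if (u : ℕ) < e then (u : ℕ) + 1 else 0 := by
  induction e with
  | zero => simp [rotState]
  | succ e ih =>
    have hp : primaryOf f g perf (e + 1) = ⟨e, by omega⟩ := by
      have : e % (3 * f + 1) = e := Nat.mod_eq_of_lt (by omega)
      simp [primaryOf, elect, he, Fin.ofNat, this]
    rw [rotState_succ, hp]
    by_cases h : u = ⟨e, by omega⟩
    · subst h; simp
    · rw [Function.update_of_ne h, ih (by omega)]
      have : (u : ℕ) ≠ e := fun h' => h (Fin.ext h')
      split_ifs <;> omega

theorem last_window (f g : ℕ) (perf : ℕ → ℕ) (hg : 3 * f + 1 ≤ g) (e : ℕ) (he : 3 * f + 1 ≤ e) :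
    Function.Injective (rotState f g perf e).last ∧
      ∀ u, e + 1 ≤ (rotState f g perf e).last u + g := by
  induction e, he using Nat.le_induction with
  | base =>
    have h : ∀ u, (rotState f g perf (3 * f + 1)).last u = (u : ℕ) + 1 := fun u => by
      rw [last_initial f g perf _ le_rfl, if_pos u.2]
    refine ⟨fun u w huw => ?_, fun u => ?_⟩
    · rw [h, h] at huw; exact Fin.ext (by omega)
    · rw [h]; omega
  | succ e he ih =>
    obtain ⟨hinj, hw⟩ := ih
    rw [rotState_succ]
    set s := rotState f g perf e with hs
    have hle : ∀ u, s.last u ≤ e := fun u => (primaryOf_last f g perf e u).1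
    set p := primaryOf f g perf (e + 1) with hp
    constructor
    · intro u w huw
      by_cases hu : u = p <;> by_cases hw' : w = p
      · rw [hu, hw']
      · rw [hu, Function.update_self, Function.update_of_ne hw'] at huw
        have := hle w; omega
      · rw [hw', Function.update_self, Function.update_of_ne hu] at huw
        have := hle u; omega
      · rw [Function.update_of_ne hu, Function.update_of_ne hw'] at huw
        exact hinj huw
    · intro u
      by_cases hu : u = p
      · rw [hu, Function.update_self]; omega
      · rw [Function.update_of_ne hu]
        have h1 := hw u
        by_contra hlt
        have heq : s.last u + g = e + 1 := by omega
        apply hu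
        have hfind : (List.finRange (3 * f + 1)).find? (fun w => decide (s.last w + g = e + 1)) =
            some u := by
          cases hc : (List.finRange (3 * f + 1)).find? (fun w => decide (s.last w + g = e + 1)) with
          | none =>
            have := List.find?_eq_none.1 hc u (List.mem_finRange u)
            simp [heq] at this
          | some w =>
            have := List.find?_some hc
            simp only [decide_eq_true_eq] at this
            rw [hinj (show s.last w = s.last u by omega)]
        have : ¬ e + 1 ≤ 3 * f + 1 := by omega
        rw [hp]
        simp only [primaryOf, elect, if_neg this, Nat.add_sub_cancel, ← hs, hfind]

theorem primaryOf_frequently (f g : ℕ) (perf : ℕ → ℕ) (hg : 3 * f + 1 ≤ g) (q : Fin (3 * f + 1)) :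
    ∃ᶠ e in Filter.atTop, primaryOf f g perf e = q := by
  rw [Filter.frequently_atTop]
  intro N
  have h := (last_window f g perf hg (N + g) (by omega)).2 q
  exact ⟨_, by omega, (primaryOf_last f g perf (N + g) q).2 (by omega)⟩

theorem exists_top {ι : Type*} [Fintype ι] (s : ι → ℚ) (r : ℕ) (hr : r ≤ Fintype.card ι) :
    ∃ R : Finset ι, R.card = r ∧ ∀ u ∈ R, ∀ w ∉ R, s w ≤ s u := by
  induction r with
  | zero => exact ⟨∅, by simp⟩
  | succ r ih =>
    obtain ⟨R, hR, h⟩ := ih (by omega)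
    have hne : (Finset.univ \ R).Nonempty := by
      rw [← Finset.card_pos, Finset.card_sdiff_of_subset (Finset.subset_univ R), Finset.card_univ]
      omega
    obtain ⟨x, hx, hmax⟩ := Finset.exists_max_image (Finset.univ \ R) s hne
    have hx' : x ∉ R := by simpa using hx
    refine ⟨insert x R, by rw [Finset.card_insert_of_notMem hx', hR], fun u hu w hw => ?_⟩
    rw [Finset.mem_insert, not_or] at hw
    rcases Finset.mem_insert.1 hu with rfl | hu
    · exact hmax w (by simp [hw.2])
    · exact h u hu w hw.2

theorem exists_fibers {ι β : Type*} [Fintype ι] [DecidableEq ι] [Fintype β] (t : ι → ℕ) (j : ι → β)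
    (hj : Function.Injective j) (ht : ∀ v, 1 ≤ t v) (hs : ∑ v, t v = Fintype.card β) :
    ∃ r : β → ι, (∀ v, r (j v) = v) ∧
      ∀ v, (Finset.univ.filter (fun b => r b = v)).card = t v := by
  have hcard : Fintype.card {b // b ∉ Set.range j} = Fintype.card (Σ v, Fin (t v - 1)) := by
    rw [Fintype.card_subtype_compl, Fintype.card_sigma]
    have h1 : Fintype.card {b // b ∈ Set.range j} = Fintype.card ι :=
      Fintype.card_congr (Equiv.ofInjective j hj).symm
    have h2 : ∑ v, t v = ∑ v, (t v - 1) + Fintype.card ι := by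
      rw [← Finset.card_univ, Finset.card_eq_sum_ones, ← Finset.sum_add_distrib]
      exact Finset.sum_congr rfl fun v _ => by have := ht v; omega
    simp only [Fintype.card_fin]
    rw [h1]; omega
  obtain ⟨φ⟩ := Fintype.card_eq.1 hcard
  let r : β → ι := fun b => if h : b ∈ Set.range j then h.choose else (φ ⟨b, h⟩).1
  have hr : ∀ v, r (j v) = v := fun v => by
    have h : j v ∈ Set.range j := ⟨v, rfl⟩
    simp only [r, dif_pos h]
    exact hj h.choose_spec
  refine ⟨r, hr, fun v => ?_⟩
  have hset : Finset.univ.filter (fun b => r b = v) =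
      insert (j v) (Finset.univ.image (fun i : Fin (t v - 1) => (φ.symm ⟨v, i⟩).1)) := by
    ext b
    simp only [Finset.mem_filter, Finset.mem_univ, true_and, Finset.mem_insert, Finset.mem_image]
    constructor
    · intro hb
      by_cases h : b ∈ Set.range j
      · obtain ⟨w, rfl⟩ := h
        rw [hr] at hb; subst hb; exact Or.inl rfl
      · right
        simp only [r, dif_neg h] at hb
        subst hb
        exact ⟨(φ ⟨b, h⟩).2, by simp⟩
    · rintro (rfl | ⟨i, rfl⟩)
      · exact hr v
      · have h := (φ.symm ⟨v, i⟩).2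
        simp only [r, dif_neg h]
        simp
  rw [hset, Finset.card_insert_of_notMem, Finset.card_image_of_injective]
  · simp only [Finset.card_univ, Fintype.card_fin]; have := ht v; omega
  · intro a b hab
    have := φ.symm.injective (Subtype.ext hab)
    simpa using this
  · simp only [Finset.mem_image, Finset.mem_univ, true_and, not_exists]
    intro i hi
    exact (φ.symm ⟨v, i⟩).2 ⟨v, hi.symm⟩

theorem exists_shares (f m : ℕ) (hm : 1 ≤ m) (C : Fin (3 * f + 1) → ℕ) (hC : ∀ v, 1 ≤ C v) :
    ∃ R : Finset (Fin (3 * f + 1)),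
      (∑ v, (baseBuckets f m C v + if v ∈ R then 1 else 0) = m * (3 * f + 1)) ∧
      ∀ u ∈ R, ∀ w ∉ R, bucketScore f m C w ≤ bucketScore f m C u := by
  set A : ℕ := (m - 1) * (3 * f + 1) with hA
  let x : Fin (3 * f + 1) → ℚ := fun v => (C v : ℚ) / (∑ u, C u : ℕ) * (A : ℚ)
  have hpos : (0 : ℚ) < ((∑ u, C u : ℕ) : ℚ) := by
    have : 0 < ∑ u, C u := Finset.sum_pos (fun v _ => hC v) Finset.univ_nonempty
    exact_mod_cast this
  have hx : ∀ v, 0 ≤ x v := fun v => by positivity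
  have hsum : ∑ v, x v = A := by
    rw [← Finset.sum_mul, ← Finset.sum_div]
    rw [← Nat.cast_sum, div_self hpos.ne', one_mul]
  have h1 : (∑ v, ⌊x v⌋₊ : ℕ) ≤ A := by
    have : ((∑ v, ⌊x v⌋₊ : ℕ) : ℚ) ≤ A := by
      rw [← hsum, Nat.cast_sum]
      exact Finset.sum_le_sum fun v _ => Nat.floor_le (hx v)
    exact_mod_cast this
  have h2 : A ≤ (∑ v, ⌊x v⌋₊ : ℕ) + (3 * f + 1) := by
    have : (A : ℚ) ≤ ((∑ v, ⌊x v⌋₊ + (3 * f + 1) : ℕ) : ℚ) := by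
      have h : ∑ v, x v ≤ ∑ v, ((⌊x v⌋₊ : ℚ) + 1) :=
        Finset.sum_le_sum fun v _ => (Nat.lt_floor_add_one (x v)).le
      rw [← hsum]
      refine h.trans (le_of_eq ?_)
      rw [Finset.sum_add_distrib]
      simp
    exact_mod_cast this
  have hb : ∑ v, baseBuckets f m C v = (∑ v, ⌊x v⌋₊ : ℕ) + (3 * f + 1) := by
    simp only [baseBuckets, Finset.sum_add_distrib]
    simp [x, hA]
  have hmn : m * (3 * f + 1) = A + (3 * f + 1) := by
    obtain ⟨m, rfl⟩ : ∃ m', m = m' + 1 := ⟨m - 1, by omega⟩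
    simp only [hA, Nat.add_sub_cancel]; ring
  obtain ⟨R, hR, htop⟩ := exists_top (bucketScore f m C) (A - ∑ v, ⌊x v⌋₊) (by simp; omega)
  refine ⟨R, ?_, htop⟩
  rw [Finset.sum_add_distrib, hb, Finset.sum_ite_mem, Finset.univ_inter, Finset.sum_const, hR, hmn]
  simp; omega

theorem exists_isBucketRotation (f m g : ℕ) (perf : ℕ → ℕ) (hm : 1 ≤ m) (hg : 3 * f + 1 ≤ g) :
    ∃ rot, IsBucketRotation f m (primaryOf f g perf) rot := by
  have hfreq := primaryOf_frequently f g perf hg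
  generalize primaryOf f g perf = p at hfreq ⊢
  have hmn : 3 * f + 1 ≤ m * (3 * f + 1) := Nat.le_mul_of_pos_left _ hm
  have hpos : 0 < m * (3 * f + 1) := by omega
  let s : ℕ → ℕ := fun e => Nat.count (fun e' => p e' = p e) e
  let j : ℕ → Fin (3 * f + 1) → Fin (m * (3 * f + 1)) := fun e v => ⟨(s e + v) % (m * (3 * f + 1)), Nat.mod_lt _ hpos⟩
  have hj : ∀ e, Function.Injective (j e) := fun e v w h => by
    have h' : (s e + v) % (m * (3 * f + 1)) = (s e + w) % (m * (3 * f + 1)) := congrArg Fin.val h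
    have h'' : (v : ℕ) ≡ w [MOD m * (3 * f + 1)] := Nat.ModEq.add_left_cancel' (s e) h'
    exact Fin.ext (Nat.ModEq.eq_of_lt_of_lt h'' (v.2.trans_le hmn) (w.2.trans_le hmn))
  have key : ∀ (e : ℕ) (C : Fin (3 * f + 1) → ℕ), ∃ r : Fin (m * (3 * f + 1)) → Fin (3 * f + 1), (∀ v, 1 ≤ C v) →
      (∀ v, r (j e v) = v) ∧ ∃ R : Finset (Fin (3 * f + 1)),
        (∀ v, (Finset.univ.filter (fun b => r b = v)).card =
          baseBuckets f m C v + if v ∈ R then 1 else 0) ∧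
        ∀ u ∈ R, ∀ w ∉ R, bucketScore f m C w ≤ bucketScore f m C u := by
    intro e C
    by_cases hC : ∀ v, 1 ≤ C v
    · obtain ⟨R, h1, h2⟩ := exists_shares f m hm C hC
      obtain ⟨r, hr1, hr2⟩ := exists_fibers
        (fun v => baseBuckets f m C v + if v ∈ R then 1 else 0) (j e) (hj e)
        (fun v => by simp only [baseBuckets]; omega) (by simpa using h1)
      exact ⟨r, fun _ => ⟨hr1, R, hr2, h2⟩⟩
    · exact ⟨fun _ => 0, fun h => absurd h hC⟩
  choose rot hrot using key
  refine ⟨rot, fun e C hC => (hrot e C hC).2, fun C hC v b => ⟨Finset.univ, by simp; omega, ?_⟩⟩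
  intro q _
  rw [Filter.frequently_atTop]
  intro N
  have hinf : {e | p e = q}.Infinite :=
    Nat.frequently_atTop_iff_infinite.1 (hfreq q)
  set c := b + m * (3 * f + 1) * (N + 1) - v with hc
  have hge : m * (3 * f + 1) * (N + 1) ≥ m * (3 * f + 1) + N := by nlinarith
  have hv := v.2
  have he : p (Nat.nth (fun e => p e = q) c) = q := Nat.nth_mem_of_infinite hinf c
  refine ⟨Nat.nth (fun e => p e = q) c, ?_, he, ?_⟩
  · have := (Nat.nth_strictMono hinf).le_apply (x := c)
    omega
  · have hs : s (Nat.nth (fun e => p e = q) c) = c := by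
      simp only [s, he]
      exact Nat.count_nth_of_infinite hinf c
    have : j (Nat.nth (fun e => p e = q) c) v = b := by
      apply Fin.ext
      simp only [j, hs]
      have : c + v = b + m * (3 * f + 1) * (N + 1) := by omega
      rw [this, Nat.add_mul_mod_self_left, Nat.mod_eq_of_lt b.2]
    rw [← this]
    exact (hrot _ _ (hC _)).1 v

variable {Client : Type*}

namespace Protocol

/-- The replicas. -/
abbrev Rep (P : Protocol Client) : Type := Fin (3 * P.f + 1)

/-- The hash buckets. -/
abbrev Bucket (P : Protocol Client) : Type := Fin (P.m * (3 * P.f + 1))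

/-- The primary of epoch `e`. -/
def primary (P : Protocol Client) (e : ℕ) : P.Rep := primaryOf P.f P.g P.perf e

/-- The standing requirements on the configuration. -/
structure WellFormed (P : Protocol Client) : Prop where
  m_pos : 1 ≤ P.m
  k_pos : 1 ≤ P.k
  Cmin_pos : 1 ≤ P.Cmin
  window : 3 * P.f + 1 ≤ P.g
  delta_pos : 0 < P.Δ
  rotation : IsBucketRotation P.f P.m P.primary P.rot

end Protocol

/-! ### Messages

Hash functions and signatures are ideal: a digest is represented by the value that it identifies, and
a combined signature by the statement that it certifies. -/

/-- A client request. -/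
structure Request (Client Op : Type*) where
  op : Op
  timestamp : ℕ
  client : Client

/-- The digest `h(sn ‖ e ‖ r)`; the value `none` is the null request. -/
structure Entry (Client Op : Type*) where
  epoch : ℕ
  sn : ℕ
  val : Option (Request Client Op)

/-- The configuration of an epoch, shared by reliable broadcast. -/
structure Config (P : Protocol Client) (Op : Type*) where
  /-- the replicas whose epoch-change messages were used -/
  callers : Finset P.Rep
  /-- the number `C_v(e)` of requests of each leader -/
  load : P.Rep → ℕ
  /-- the leader that serves a bucket -/
  bucket : P.Bucket → P.Rep
  /-- the sequence numbers led by each leader, in the order of the local sequence numbers -/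
  own : P.Rep → List ℕ
  /-- the value with which a hanging sequence number is proposed again -/
  hang : ℕ → Option (Option (Request Client Op))

/-- A checkpoint: the leader's requests of an epoch, with their sequence numbers, up to the local
sequence number `log.length`. -/
structure Ckpt (P : Protocol Client) (Op : Type*) where
  epoch : ℕ
  leader : P.Rep
  log : List (ℕ × Option (Request Client Op))

/-- An epoch-change message: stable checkpoints with their certificates, prepared-certificates and
commit-certificates, together with the configurations (certified by the reliable broadcast) to which
they refer. -/
structure EpochChange (P : Protocol Client) (Op : Type*) where
  sender : P.Rep
  epoch : ℕ
  configs : Finset (ℕ × Config P Op)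
  stable : Finset (Ckpt P Op)
  prepared : Finset (Entry Client Op)
  committed : Finset (Entry Client Op)

/-- The messages of the protocol.  `init`, `echo` and `ready` are the three phases of the reliable
broadcast; `fetch` and `supply` are used to obtain missing information from other replicas. -/
inductive Msg (P : Protocol Client) (Op : Type*)
  | request (r : Request Client Op)
  | prePrepare (d : Entry Client Op)
  | prepare (d : Entry Client Op)
  | preparedCert (d : Entry Client Op)
  | commit (d : Entry Client Op)
  | commitCert (d : Entry Client Op)
  | checkpoint (c : Ckpt P Op)
  | checkpointCert (c : Ckpt P Op)
  | epochChange (c : EpochChange P Op)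
  | init (e : ℕ) (cfg : Config P Op)
  | echo (e : ℕ) (cfg : Config P Op)
  | ready (e : ℕ) (cfg : Config P Op)
  | newEpoch (e : ℕ) (V : Finset (EpochChange P Op))
  | fetch (e : ℕ)
  | supply (ds : Finset (Entry Client Op))

variable {P : Protocol Client} {Op : Type*}

/-- The partially signed messages of other replicas that a message forwards. -/
def Msg.forwarded : Msg P Op → Set (P.Rep × Msg P Op)
  | .newEpoch _ V => {x | ∃ c ∈ V, x = (c.sender, .epochChange c)}
  | _ => ∅

/-- The statements for which an epoch-change message contains a combined signature. -/
def EpochChange.combined (c : EpochChange P Op) : Set (Msg P Op) :=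
  {s | (∃ x ∈ c.configs, s = .ready x.1 x.2) ∨ (∃ x ∈ c.stable, s = .checkpoint x) ∨
    (∃ d ∈ c.prepared, s = .prepare d) ∨ (∃ d ∈ c.committed, s = .commit d)}

/-- The statements for which a message contains a combined signature, each given as the message that
carries the partial signatures. -/
def Msg.combined : Msg P Op → Set (Msg P Op)
  | .preparedCert d => {.prepare d}
  | .commitCert d => {.commit d}
  | .checkpointCert c => {.checkpoint c}
  | .epochChange c => c.combined
  | .newEpoch _ V => {s | ∃ c ∈ V, s ∈ c.combined}
  | .supply ds => {s | ∃ d ∈ ds, s = .commit d}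
  | _ => ∅

/-- The client requests that a message introduces, signed by their clients. -/
def Msg.requests : Msg P Op → Set (Request Client Op)
  | .request r => {r}
  | .prePrepare d => {r | d.val = some r}
  | _ => ∅

/-! ### The configuration of a new epoch

It is computed from the set `V` of epoch-change messages used by the primary. -/

section NewConfig

/-- `sn` is settled: below a stable checkpoint, or covered by a commit-certificate. -/
def Settled (V : Finset (EpochChange P Op)) (sn : ℕ) : Prop :=
  (∃ c ∈ V, ∃ s ∈ c.stable, ∃ x, (sn, x) ∈ s.log) ∨ ∃ c ∈ V, ∃ d ∈ c.committed, d.sn = sn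

def preparedIn (V : Finset (EpochChange P Op)) : Finset (Entry Client Op) :=
  V.biUnion EpochChange.prepared

/-- `sn` belongs to a leader in the configuration `K` of some epoch, and a later sequence number of
that leader was prepared or committed in that epoch. -/
def InGap (K : Finset (ℕ × Config P Op)) (V : Finset (EpochChange P Op)) (sn : ℕ) : Prop :=
  ∃ x ∈ K, ∃ v, ∃ l₁ l₂, x.2.own v = l₁ ++ sn :: l₂ ∧
    ∃ d ∈ preparedIn V ∪ V.biUnion EpochChange.committed, d.epoch = x.1 ∧ d.sn ∈ l₂

/-- The value with which a hanging sequence number is proposed again: the value prepared in the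
highest epoch, or the null request in a gap. -/
def hangVal (K : Finset (ℕ × Config P Op)) (V : Finset (EpochChange P Op)) (sn : ℕ) :
    Option (Option (Request Client Op)) :=
  if Settled V sn then none
  else if h : ∃ d ∈ preparedIn V, d.sn = sn ∧
      ∀ d' ∈ preparedIn V, d'.sn = sn → d'.epoch ≤ d.epoch then
    some h.choose.val
  else if InGap K V sn then some none
  else none

/-- The last leader of `sn` according to the known configurations. -/
def lastLeader (K : Finset (ℕ × Config P Op)) (sn : ℕ) : P.Rep :=
  if h : ∃ v : P.Rep, ∃ x ∈ K, sn ∈ x.2.own v ∧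
      ∀ y ∈ K, (∃ w, sn ∈ y.2.own w) → y.1 ≤ x.1 then h.choose else 0

/-- The hanging sequence numbers. -/
def hangSns (K : Finset (ℕ × Config P Op)) (V : Finset (EpochChange P Op)) : Finset ℕ :=
  ((preparedIn V).image Entry.sn ∪
      K.biUnion (fun x => Finset.univ.biUnion (fun v => (x.2.own v).toFinset))).filter
    (fun sn => (hangVal K V sn).isSome)

/-- The number `c_v(e)` of requests committed under leader `v` in epoch `e`, according to `V`. -/
def committedUnder (K : Finset (ℕ × Config P Op)) (V : Finset (EpochChange P Op)) (e : ℕ)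
    (v : P.Rep) : ℕ :=
  (((K.filter (fun x => x.1 = e)).biUnion (fun x => (x.2.own v).toFinset)).filter (fun sn =>
    ∃ c ∈ V, (∃ d ∈ c.committed, d.epoch = e ∧ d.sn = sn) ∨
      ∃ s ∈ c.stable, s.epoch = e ∧ ∃ x, (sn, x) ∈ s.log)).card

/-- The number `C_v(e)` of requests assigned to leader `v` in epoch `e`. -/
def loadOf (K : Finset (ℕ × Config P Op)) (V : Finset (EpochChange P Op)) : ℕ → P.Rep → ℕ
  | 0, _ => P.Cmin
  | 1, _ => P.Cmin
  | e + 2, v =>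
    if committedUnder K V (e + 1) v < loadOf K V (e + 1) v then
      max P.Cmin ((Finset.range (P.f + 1)).sup (fun i => committedUnder K V (e + 1 - i) v))
    else 2 * committedUnder K V (e + 1) v

/-- The configuration of epoch `e`, given the earlier configurations `K` and the epoch-change messages
`V`.  A hanging request is led by the leader that serves its bucket, a null request by the leader of
its sequence number.  Each leader leads first its `O_v` hanging sequence numbers and then `C_v - O_v`
fresh ones (at least one), assigned to the leaders one after the other from the available numbers. -/
def buildConfig (P : Protocol Client) (Op : Type*) (e : ℕ) (K : Finset (ℕ × Config P Op))
    (V : Finset (EpochChange P Op)) : Config P Op :=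
  let C : P.Rep → ℕ := loadOf K V e
  let bucket : P.Bucket → P.Rep := P.rot e C
  let O : P.Rep → Finset ℕ := fun v => (hangSns K V).filter (fun sn =>
    ∃ x, hangVal K V sn = some x ∧
      (match x with
        | some r => bucket (P.hash r.client)
        | none => lastLeader K sn) = v)
  let fresh : P.Rep → ℕ := fun v => max 1 (C v - (O v).card)
  let Available : ℕ → Prop := fun sn => 1 ≤ sn ∧ ¬ Settled V sn ∧ hangVal K V sn = none
  { callers := V.image EpochChange.sender
    load := C
    bucket := bucket
    own := fun v => (O v).sort ++
      (List.range (fresh v)).map (fun i => Nat.nth Available (∑ w ∈ Finset.Iio v, fresh w + i))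
    hang := hangVal K V }

/-- The configuration of the first epoch. -/
def firstConfig (P : Protocol Client) (Op : Type*) : Config P Op := buildConfig P Op 1 ∅ ∅

/-- The configuration of epoch `e` determined by the epoch-change messages `V`. -/
def newConfig (P : Protocol Client) {Op : Type*} (e : ℕ) (V : Finset (EpochChange P Op)) :
    Config P Op :=
  buildConfig P Op e (insert (1, firstConfig P Op) (V.biUnion EpochChange.configs)) V

/-- `V` consists of `2f+1` epoch-change messages for epoch `e` from distinct replicas. -/
def ValidV (P : Protocol Client) {Op : Type*} (e : ℕ) (V : Finset (EpochChange P Op)) : Prop :=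
  V.card = 2 * P.f + 1 ∧ (∀ c ∈ V, c.epoch = e) ∧
    ∀ c ∈ V, ∀ c' ∈ V, c.sender = c'.sender → c = c'

end NewConfig

/-! ### Local state of a replica -/

structure RState (P : Protocol Client) (Op : Type*) where
  /-- the epoch entered or called for last -/
  epoch : ℕ
  /-- whether the replica has entered `epoch`; if not, it is in the epoch-change for `epoch` -/
  active : Prop
  /-- number of consecutive unsuccessful epoch-changes -/
  fails : ℕ
  /-- received messages with their senders (`none` stands for a client) -/
  inbox : Finset (Option P.Rep × Msg P Op)
  /-- client requests in the order of their arrival -/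
  queue : List (Request Client Op)
  /-- known commit-certificates -/
  certs : Finset (Entry Client Op)
  /-- prepared-certificates accepted in their epoch -/
  prepared : Finset (Entry Client Op)
  /-- stable checkpoints -/
  stable : Finset (Ckpt P Op)
  /-- configuration of the epoch entered last -/
  cfg : Config P Op
  /-- certified configurations of the entered epochs -/
  configs : Finset (ℕ × Config P Op)
  /-- pre-prepares accepted in the current epoch -/
  accepted : ℕ → Option (Option (Request Client Op))
  /-- own proposals as a leader in the current epoch -/
  proposed : ℕ → Option (Request Client Op)
  /-- the last epoch-change message sent -/
  call : Option (EpochChange P Op)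
  /-- as primary: the epoch-change messages selected for the current epoch -/
  selected : Option (Finset (EpochChange P Op))
  /-- configurations echoed and confirmed in the reliable broadcast for the current epoch -/
  echoed : Option (Config P Op)
  readied : Option (Config P Op)
  /-- commit-certificates supplied on demand -/
  supplied : Finset (P.Rep × Finset (Entry Client Op))
  /-- expiry times of the epoch timer, the epoch-change timer and the no-progress timers -/
  epochTimer : ℝ
  changeTimer : Option ℝ
  progressTimer : P.Rep → ℝ

/-- Replicas start in epoch `1` at time `0`. -/
def RState.start (P : Protocol Client) (Op : Type*) : RState P Op where
  epoch := 1
  active := True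
  fails := 0
  inbox := ∅
  queue := []
  certs := ∅
  prepared := ∅
  stable := ∅
  cfg := firstConfig P Op
  configs := ∅
  accepted := (firstConfig P Op).hang
  proposed := fun _ => none
  call := none
  selected := none
  echoed := none
  readied := none
  supplied := ∅
  epochTimer := P.T
  changeTimer := none
  progressTimer := fun _ => 5 * P.Δ + P.Tp

/-- The request `r` is committed locally: a commit-certificate for it is known. -/
def RState.HasCommitted (s : RState P Op) (r : Request Client Op) : Prop :=
  ∃ d ∈ s.certs, d.val = some r

/-- At least `q` replicas satisfy `S`. -/
def AtLeast (P : Protocol Client) (q : ℕ) (S : P.Rep → Prop) : Prop :=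
  ∃ W : Finset P.Rep, q ≤ W.card ∧ ∀ w ∈ W, S w

def RState.Got (s : RState P Op) (w : P.Rep) (m : Msg P Op) : Prop := (some w, m) ∈ s.inbox

/-- Low watermark of leader `v`: the local sequence number of its last stable checkpoint in the
current epoch. -/
def RState.low (s : RState P Op) (v : P.Rep) : ℕ :=
  (s.stable.filter (fun c => c.epoch = s.epoch ∧ c.leader = v)).sup (fun c => c.log.length)

/-- All requests assigned to `v` in the current epoch are committed locally. -/
def RState.Finished (s : RState P Op) (v : P.Rep) : Prop :=
  ∀ sn ∈ s.cfg.own v, ∃ x, (⟨s.epoch, sn, x⟩ : Entry Client Op) ∈ s.certs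

/-- The configuration `cfg` is delivered by the reliable broadcast for the current epoch. -/
def RState.Delivered (s : RState P Op) (cfg : Config P Op) : Prop :=
  AtLeast P (2 * P.f + 1) (fun w => s.Got w (.ready s.epoch cfg))

/-! ### Sending messages -/

/-- `s.Sends u w m`: in state `s`, replica `u` is bound to send `m` to `w` (once).  Replicas also send
messages to themselves, so that the own contribution counts towards the quorums. -/
inductive RState.Sends (s : RState P Op) (u : P.Rep) : P.Rep → Msg P Op → Prop
  /-- as leader: pre-prepare -/
  | prePrepare (w : P.Rep) (sn : ℕ) (r : Request Client Op) :
      s.active → s.proposed sn = some r → Sends s u w (.prePrepare ⟨s.epoch, sn, some r⟩)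
  /-- as backup: prepare, sent to the leader of the sequence number -/
  | prepare (w : P.Rep) (sn : ℕ) (x : Option (Request Client Op)) :
      s.active → s.accepted sn = some x → sn ∈ s.cfg.own w →
      Sends s u w (.prepare ⟨s.epoch, sn, x⟩)
  /-- as leader: prepared-certificate -/
  | preparedCert (w : P.Rep) (d : Entry Client Op) :
      s.active → d.epoch = s.epoch → d.sn ∈ s.cfg.own u → s.accepted d.sn = some d.val →
      AtLeast P (2 * P.f + 1) (fun x => s.Got x (.prepare d)) → Sends s u w (.preparedCert d)
  /-- as backup: commit -/
  | commit (w : P.Rep) (d : Entry Client Op) :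
      s.active → d.epoch = s.epoch → d ∈ s.prepared → d.sn ∈ s.cfg.own w →
      Sends s u w (.commit d)
  /-- as leader: commit-certificate -/
  | commitCert (w : P.Rep) (d : Entry Client Op) :
      s.active → d.epoch = s.epoch → d.sn ∈ s.cfg.own u →
      AtLeast P (2 * P.f + 1) (fun x => s.Got x (.commit d)) → Sends s u w (.commitCert d)
  /-- as backup: checkpoint, after delivering in order the leader's requests up to a local sequence
  number divisible by `k` -/
  | checkpoint (c : Ckpt P Op) :
      s.active → c.epoch = s.epoch → c.log ≠ [] → P.k ∣ c.log.length →
      List.Forall₂ (fun sn y => y.1 = sn ∧ (⟨s.epoch, sn, y.2⟩ : Entry Client Op) ∈ s.certs)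
        ((s.cfg.own c.leader).take c.log.length) c.log →
      Sends s u c.leader (.checkpoint c)
  /-- as leader: checkpoint-certificate -/
  | checkpointCert (w : P.Rep) (c : Ckpt P Op) :
      s.active → c.epoch = s.epoch → c.leader = u →
      AtLeast P (2 * P.f + 1) (fun x => s.Got x (.checkpoint c)) → Sends s u w (.checkpointCert c)
  | epochChange (w : P.Rep) (c : EpochChange P Op) :
      s.call = some c → Sends s u w (.epochChange c)
  /-- as primary: start of the reliable broadcast -/
  | init (w : P.Rep) (V : Finset (EpochChange P Op)) :
      s.selected = some V → Sends s u w (.init s.epoch (newConfig P s.epoch V))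
  | echo (w : P.Rep) (cfg : Config P Op) : s.echoed = some cfg → Sends s u w (.echo s.epoch cfg)
  | ready (w : P.Rep) (cfg : Config P Op) : s.readied = some cfg → Sends s u w (.ready s.epoch cfg)
  /-- as primary: new-epoch, after the reliable broadcast -/
  | newEpoch (w : P.Rep) (V : Finset (EpochChange P Op)) :
      s.selected = some V → s.Delivered (newConfig P s.epoch V) →
      Sends s u w (.newEpoch s.epoch V)
  /-- upon entering a new epoch: ask for missing information -/
  | fetch (w : P.Rep) : s.active → 2 ≤ s.epoch → Sends s u w (.fetch s.epoch)
  | supply (w : P.Rep) (ds : Finset (Entry Client Op)) :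
      (w, ds) ∈ s.supplied → Sends s u w (.supply ds)

/-! ### Reaction to a received message -/

/-- The state after receiving `m` from `src` at time `t`.  A commit-certificate from leader `v` resets
the no-progress timer of `v` unless the requests of `v` were already finished; the no-progress timers
are set for the first time `5Δ` after the start of the epoch. -/
def RState.receive (s : RState P Op) (t : ℝ) (src : Option P.Rep) (m : Msg P Op) : RState P Op :=
  let s₁ : RState P Op := { s with inbox := insert (src, m) s.inbox }
  match m with
  | .request r => { s₁ with queue := if r ∈ s.queue then s.queue else s.queue ++ [r] }
  | .commitCert d =>
    { s₁ with
      certs := insert d s.certs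
      progressTimer := fun v =>
        if s.active ∧ src = some v ∧ d.epoch = s.epoch ∧ d.sn ∈ s.cfg.own v ∧ ¬ s.Finished v then
          max (s.progressTimer v) (t + P.Tp)
        else s.progressTimer v }
  | .checkpointCert c => { s₁ with stable := insert c s.stable }
  | .fetch _ =>
    match src with
    | some w => { s₁ with supplied := insert (w, s.certs) s.supplied }
    | none => s₁
  | .supply ds => { s₁ with certs := s.certs ∪ ds }
  | _ => s₁

/-! ### Local actions -/

/-- The sequence number was already used in the current epoch, or hangs from an earlier one. -/
def RState.Used (s : RState P Op) (sn : ℕ) : Prop :=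
  s.cfg.hang sn ≠ none ∨ s.proposed sn ≠ none

/-- Leader `u` may propose `r`: it belongs to an active bucket of `u`, and it is neither committed nor
pending. -/
def RState.Eligible (s : RState P Op) (u : P.Rep) (r : Request Client Op) : Prop :=
  s.cfg.bucket (P.hash r.client) = u ∧ ¬ s.HasCommitted r ∧
    (∀ sn, s.cfg.hang sn ≠ some (some r)) ∧ ∀ sn, s.proposed sn ≠ some r

/-- The checkpoint information has settled the entry. -/
def RState.Covered (s : RState P Op) (d : Entry Client Op) : Prop :=
  ∃ c ∈ s.stable, ∃ x, (d.sn, x) ∈ c.log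

/-- Calling an epoch-change for epoch `e`: the replica stops participating in its previous epoch and
issues an epoch-change message. -/
def RState.callFor (s : RState P Op) (u : P.Rep) (e : ℕ) : RState P Op :=
  { s with
    epoch := e
    active := False
    fails := if s.active then 0 else s.fails + 1
    changeTimer := none
    accepted := fun _ => none
    proposed := fun _ => none
    selected := none
    echoed := none
    readied := none
    call := some
      { sender := u
        epoch := e
        configs := s.configs
        stable := s.stable
        prepared := s.prepared.filter
          (fun d => ¬ s.Covered d ∧ ¬ ∃ d' ∈ s.certs, d'.sn = d.sn)
        committed := s.certs.filter (fun d => ¬ s.Covered d) } }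

/-- Entering the epoch for which an epoch-change is in progress, at time `t`. -/
def RState.enter (s : RState P Op) (t : ℝ) (V : Finset (EpochChange P Op)) : RState P Op :=
  { s with
    active := True
    fails := 0
    certs := s.certs ∪ V.biUnion EpochChange.committed
    stable := s.stable ∪ V.biUnion EpochChange.stable
    cfg := newConfig P s.epoch V
    configs := insert (s.epoch, newConfig P s.epoch V) s.configs
    accepted := (newConfig P s.epoch V).hang
    proposed := fun _ => none
    epochTimer := t + P.T
    changeTimer := none
    progressTimer := fun _ => t + 5 * P.Δ + P.Tp }

/-- Value of the epoch-change timer: the default value, doubled for each unsuccessful consecutive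
epoch-change after the first `f` ones. -/
def changeTimeout (P : Protocol Client) (fails : ℕ) : ℝ :=
  if P.f ≤ fails then P.Te * 2 ^ (fails - P.f + 1) else P.Te

/-- Another replica `w` has called for epoch `e`. -/
def RState.CalledBy (s : RState P Op) (w : P.Rep) (e : ℕ) : Prop :=
  ∃ c, s.Got w (.epochChange c) ∧ c.sender = w ∧ c.epoch = e

/-- `RState.Act u t s s'`: at time `t`, replica `u` can perform a local action leading from `s` to
`s'`. -/
inductive RState.Act (u : P.Rep) (t : ℝ) (s : RState P Op) : RState P Op → Prop
  /-- as leader: propose the first eligible request with the next fresh sequence number, if that is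
  below the high watermark -/
  | propose (sn : ℕ) (r : Request Client Op) (l₁ l₂ : List ℕ) (q₁ q₂ : List (Request Client Op)) :
      s.active → s.cfg.own u = l₁ ++ sn :: l₂ → (∀ x ∈ l₁, s.Used x) → ¬ s.Used sn →
      l₁.length < s.low u + 2 * P.k →
      s.queue = q₁ ++ r :: q₂ → (∀ x ∈ q₁, ¬ s.Eligible u x) → s.Eligible u r →
      Act u t s { s with proposed := Function.update s.proposed sn (some r) }
  /-- accept a pre-prepare from the leader `v` of its sequence number, within the watermarks -/
  | acceptPrePrepare (v : P.Rep) (d : Entry Client Op) (r : Request Client Op) (l₁ l₂ : List ℕ) :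
      s.active → s.Got v (.prePrepare d) → d.epoch = s.epoch → s.accepted d.sn = none →
      s.cfg.own v = l₁ ++ d.sn :: l₂ → s.low v ≤ l₁.length →
      l₁.length < s.low v + 2 * P.k →
      d.val = some r → s.cfg.bucket (P.hash r.client) = v →
      Act u t s { s with accepted := Function.update s.accepted d.sn (some d.val) }
  /-- accept a prepared-certificate from the leader of its sequence number -/
  | acceptPrepared (v : P.Rep) (d : Entry Client Op) :
      s.active → s.Got v (.preparedCert d) → d.epoch = s.epoch → d.sn ∈ s.cfg.own v →
      d ∉ s.prepared → Act u t s { s with prepared := insert d s.prepared }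
  /-- call an epoch-change: all assigned requests are committed locally -/
  | callFinished : s.active → (∀ v, s.Finished v) → Act u t s (s.callFor u (s.epoch + 1))
  /-- call an epoch-change: the epoch timer has expired -/
  | callExpired : s.active → s.epochTimer ≤ t → Act u t s (s.callFor u (s.epoch + 1))
  /-- call an epoch-change: the no-progress timers of `2f+1` leaders have expired -/
  | callNoProgress : s.active → AtLeast P (2 * P.f + 1) (fun v => s.progressTimer v ≤ t) →
      Act u t s (s.callFor u (s.epoch + 1))
  /-- call an epoch-change: `f+1` other replicas call for higher epochs -/
  | callFollow (e : ℕ) :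
      AtLeast P (P.f + 1) (fun w => w ≠ u ∧ ∃ e', s.epoch < e' ∧ s.CalledBy w e') →
      IsLeast {e' | s.epoch < e' ∧ ∃ w, w ≠ u ∧ s.CalledBy w e'} e →
      Act u t s (s.callFor u e)
  /-- start the epoch-change timer upon `2f+1` epoch-change messages for the epoch or a higher one -/
  | startTimer : ¬ s.active → s.changeTimer = none →
      AtLeast P (2 * P.f + 1) (fun w => ∃ e', s.epoch ≤ e' ∧ s.CalledBy w e') →
      Act u t s { s with changeTimer := some (t + changeTimeout P s.fails) }
  /-- call the next epoch-change: the epoch-change timer has expired -/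
  | callNext (τ : ℝ) : ¬ s.active → s.changeTimer = some τ → τ ≤ t →
      Act u t s (s.callFor u (s.epoch + 1))
  /-- as primary: select the epoch-change messages, including the own one -/
  | select (V : Finset (EpochChange P Op)) :
      ¬ s.active → P.primary s.epoch = u → s.selected = none → ValidV P s.epoch V →
      (∀ c ∈ V, s.Got c.sender (.epochChange c)) → (∃ c ∈ V, c.sender = u) →
      Act u t s { s with selected := some V }
  | echo (cfg : Config P Op) : s.echoed = none →
      s.Got (P.primary s.epoch) (.init s.epoch cfg) → Act u t s { s with echoed := some cfg }
  | ready (cfg : Config P Op) : s.readied = none →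
      (AtLeast P (2 * P.f + 1) (fun w => s.Got w (.echo s.epoch cfg)) ∨
        AtLeast P (P.f + 1) (fun w => s.Got w (.ready s.epoch cfg))) →
      Act u t s { s with readied := some cfg }
  /-- accept a valid new-epoch message that matches the broadcast configuration -/
  | enter (V : Finset (EpochChange P Op)) : ¬ s.active →
      s.Got (P.primary s.epoch) (.newEpoch s.epoch V) → ValidV P s.epoch V →
      s.Delivered (newConfig P s.epoch V) → Act u t s (s.enter t V)

/-! ### Executions -/

inductive Event (P : Protocol Client) (Op : Type*)
  /-- the client of `r` broadcasts `r` -/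
  | submit (r : Request Client Op)
  /-- `m`, sent by `src` (`none` for a client), reaches `dst` -/
  | deliver (src : Option P.Rep) (dst : P.Rep) (m : Msg P Op)
  /-- replica `u` performs a local action -/
  | act (u : P.Rep)
  | idle

/-- An execution in the partially synchronous model, with byzantine replicas `byz` and correct clients
`good`.  Between `time i` and `time (i + 1)` the replicas are in the state `state i`; at
`time (i + 1)` the event `event i` leads to `state (i + 1)`.  Only the states of correct replicas are
meaningful. -/
structure Execution (P : Protocol Client) (Op : Type*) (byz : Finset P.Rep) (good : Set Client) where
  GST : ℝ
  time : ℕ → ℝ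
  event : ℕ → Event P Op
  state : ℕ → P.Rep → RState P Op
  time_zero : time 0 = 0
  time_mono : Monotone time
  time_unbounded : Filter.Tendsto time Filter.atTop Filter.atTop
  start : ∀ u, state 0 u = RState.start P Op
  /-- a received message changes the state of its recipient -/
  on_deliver : ∀ i src dst m, event i = .deliver src dst m →
    state (i + 1) dst = (state i dst).receive (time (i + 1)) src m ∧
      ∀ w, w ≠ dst → state (i + 1) w = state i w
  on_act : ∀ i u, event i = .act u →
    RState.Act u (time (i + 1)) (state i u) (state (i + 1) u) ∧
      ∀ w, w ≠ u → state (i + 1) w = state i w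
  on_other : ∀ i, (event i = .idle ∨ ∃ r, event i = .submit r) → state (i + 1) = state i
  /-- local actions take no time: an action of a correct replica that is possible is not delayed -/
  urgent : ∀ i t, time i ≤ t → t < time (i + 1) → ∀ u ∉ byz,
    ∀ s, ¬ RState.Act u t (state i u) s
  /-- a message that arrives from a correct replica was sent by it -/
  authentic : ∀ i w dst m, event i = .deliver (some w) dst m → w ∉ byz →
    ∃ j ≤ i, (state j w).Sends w dst m
  /-- clients send nothing but requests -/
  from_client : ∀ i dst m, event i = .deliver none dst m → ∃ r, m = .request r
  /-- requests of correct clients cannot be forged -/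
  request_authentic : ∀ i src dst m, event i = .deliver src dst m →
    (∀ w, src = some w → w ∈ byz) → ∀ r ∈ m.requests, r.client ∈ good →
    ∃ j < i, event j = .submit r
  /-- signatures of correct replicas cannot be forged: signed messages of correct replicas that a
  byzantine replica forwards were sent by them, and a combined signature needs `2f+1` replicas, of
  which the correct ones have sent their partial signatures -/
  unforgeable : ∀ i w dst m, event i = .deliver (some w) dst m → w ∈ byz →
    (∀ x ∈ m.forwarded, x.1 ∉ byz → ∃ j ≤ i, ∃ z, (state j x.1).Sends x.1 z x.2) ∧
    ∀ s ∈ m.combined, ∃ U : Finset P.Rep, U.card = 2 * P.f + 1 ∧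
      ∀ x ∈ U, x ∉ byz → ∃ j ≤ i, ∃ z, (state j x).Sends x z s
  /-- messages between correct replicas arrive, within `Δ` after stabilization -/
  network : ∀ j u w m, u ∉ byz → w ∉ byz → (state j u).Sends u w m →
    ∃ i, event i = .deliver (some u) w m ∧ time (i + 1) ≤ max (time j) GST + P.Δ
  /-- so do the requests of correct clients -/
  client_network : ∀ j r w, event j = .submit r → r.client ∈ good → w ∉ byz →
    ∃ i > j, event i = .deliver none w (.request r) ∧
      time (i + 1) ≤ max (time (j + 1)) GST + P.Δ

end

end FnF

/-!
The timers force every correct replica through every epoch. After GST, in an epoch with a correct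
primary, either all correct replicas stay for at least `17Δ`, or the first one to leave has
committed all requests of the epoch. In both cases every correct leader gets all its hanging
sequence numbers certified, and its first fresh one too unless it has nothing left to propose:
learning the configuration takes at most `6Δ`, the hanging numbers `4Δ`, a checkpoint `2Δ`, and a
fresh proposal `5Δ`. Certificates spread because every correct replica enters infinitely many
epochs and fetches what it misses.

As only `f` replicas are byzantine, among the `f + 1` primaries under which a correct leader `v`
serves the bucket of `r` infinitely often there is a correct one. By induction on the queue of `v`,
all requests older than `r` that will ever be committed are committed at `v` eventually. From then
on the first fresh number of `v` in such an epoch can only be spent on `r` or on an older request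
that will be committed, so `r` itself must be proposed and certified.
-/

namespace FnF

noncomputable section

open scoped Classical

variable {Client : Type*} {P : Protocol Client} {Op : Type*}

/-! ### Configurations -/

theorem sum_Iio_add_lt_sum_Iio_add {ι M : Type*} [PartialOrder ι] [LocallyFiniteOrderBot ι]
    [AddCommMonoid M] [PartialOrder M] [IsOrderedCancelAddMonoid M] [CanonicallyOrderedAdd M]
    {c : ι → M} {a b : ι} (hab : a < b) {i : M} (hi : i < c a) (j : M) :
    ∑ x ∈ Finset.Iio a, c x + i < ∑ x ∈ Finset.Iio b, c x + j :=
  calc ∑ x ∈ Finset.Iio a, c x + i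
      < ∑ x ∈ Finset.Iio a, c x + c a := by gcongr
    _ = ∑ x ∈ Finset.Iic a, c x := by
      rw [← Finset.Iio_insert, Finset.sum_insert (by simp), add_comm]
    _ ≤ ∑ x ∈ Finset.Iio b, c x :=
      Finset.sum_le_sum_of_subset fun _ hx =>
        Finset.mem_Iio.2 ((Finset.mem_Iic.1 hx).trans_lt hab)
    _ ≤ ∑ x ∈ Finset.Iio b, c x + j := le_self_add

section BuildConfig

variable (K : Finset (ℕ × Config P Op)) (V : Finset (EpochChange P Op))

/-- The sequence numbers that can be assigned as fresh ones. -/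
def Available (sn : ℕ) : Prop := 1 ≤ sn ∧ ¬ Settled V sn ∧ hangVal K V sn = none

theorem mem_hangSns {sn : ℕ} : sn ∈ hangSns K V ↔ hangVal K V sn ≠ none := by
  simp only [hangSns, Finset.mem_filter, Option.isSome_iff_ne_none]
  refine ⟨fun h => h.2, fun h => ⟨?_, h⟩⟩
  simp only [Finset.mem_union, Finset.mem_image, Finset.mem_biUnion, Finset.mem_univ, true_and,
    List.mem_toFinset]
  unfold hangVal at h
  split_ifs at h with _ hprep hgap
  · exact absurd rfl h
  · obtain ⟨d, hd, hsn, -⟩ := hprep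
    exact Or.inl ⟨d, hd, hsn⟩
  · obtain ⟨x, hx, v, l₁, l₂, hl, -⟩ := hgap
    exact Or.inr ⟨x, hx, v, by simp [hl]⟩
  · exact absurd rfl h

theorem finite_settled : {sn | Settled V sn}.Finite := by
  refine Set.Finite.subset (V.biUnion fun c =>
    c.stable.biUnion (fun s => (s.log.map Prod.fst).toFinset) ∪
      c.committed.image Entry.sn).finite_toSet ?_
  rintro sn (⟨c, hc, s, hs, x, hx⟩ | ⟨c, hc, d, hd, rfl⟩)
  · exact Finset.mem_biUnion.2 ⟨c, hc, Finset.mem_union_left _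
      (Finset.mem_biUnion.2 ⟨s, hs, List.mem_toFinset.2 (List.mem_map_of_mem hx)⟩)⟩
  · exact Finset.mem_biUnion.2 ⟨c, hc, Finset.mem_union_right _ (Finset.mem_image_of_mem _ hd)⟩

theorem infinite_available : {sn | Available K V sn}.Infinite := by
  have hfin : ({0} ∪ {sn | Settled V sn} ∪ (hangSns K V : Set ℕ)).Finite :=
    ((Set.finite_singleton 0).union (finite_settled V)).union (Finset.finite_toSet _)
  refine hfin.infinite_compl.mono fun sn hsn => ?_
  simp only [Set.mem_compl_iff, Set.mem_union, Set.mem_singleton_iff, Set.mem_ofPred_eq,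
    Finset.mem_coe, mem_hangSns, not_or, not_not] at hsn
  exact ⟨Nat.one_le_iff_ne_zero.2 hsn.1.1, hsn.1.2, hsn.2⟩

theorem Cmin_le_loadOf (e : ℕ) (v : P.Rep) : P.Cmin ≤ loadOf K V e v := by
  induction e with
  | zero => exact le_rfl
  | succ e ih =>
    cases e with
    | zero => exact le_rfl
    | succ e =>
      rw [loadOf]
      split_ifs with hlt
      · exact le_max_left _ _
      · omega

/-- The leader that proposes the hanging value `x` of `sn` again. -/
def hangLeader (e : ℕ) (sn : ℕ) : Option (Request Client Op) → P.Rep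
  | some r => P.rot e (loadOf K V e) (P.hash r.client)
  | none => lastLeader K sn

/-- The hanging sequence numbers led by `v`, the set `O_v` of the protocol. -/
def hangOwn (e : ℕ) (v : P.Rep) : Finset ℕ :=
  (hangSns K V).filter fun sn => ∃ x, hangVal K V sn = some x ∧ hangLeader K V e sn x = v

/-- The number of fresh sequence numbers led by `v`. -/
def freshCount (e : ℕ) (v : P.Rep) : ℕ := max 1 (loadOf K V e v - (hangOwn K V e v).card)

theorem buildConfig_own (e : ℕ) (v : P.Rep) :
    (buildConfig P Op e K V).own v = (hangOwn K V e v).sort ++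
      (List.range (freshCount K V e v)).map fun i =>
        Nat.nth (Available K V) (∑ w ∈ Finset.Iio v, freshCount K V e w + i) := by
  have hangOwn_eq : ∀ w, hangOwn K V e w = (hangSns K V).filter (fun sn =>
      ∃ x, hangVal K V sn = some x ∧
        (match x with
          | some r => P.rot e (loadOf K V e) (P.hash r.client)
          | none => lastLeader K sn) = w) := fun w =>
    Finset.filter_congr fun sn _ => exists_congr fun x => by cases x <;> rfl
  simp only [freshCount, hangOwn_eq]
  rfl

theorem mem_buildConfig_own {e : ℕ} {v : P.Rep} {sn : ℕ} :
    sn ∈ (buildConfig P Op e K V).own v ↔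
      (∃ x, hangVal K V sn = some x ∧ hangLeader K V e sn x = v) ∨
      ∃ i < freshCount K V e v,
        Nat.nth (Available K V) (∑ w ∈ Finset.Iio v, freshCount K V e w + i) = sn := by
  simp only [buildConfig_own, List.mem_append, Finset.mem_sort, hangOwn, Finset.mem_filter,
    mem_hangSns, List.mem_map, List.mem_range]
  refine or_congr_left ⟨And.right, fun h => ⟨?_, h⟩⟩
  obtain ⟨x, hx, -⟩ := h
  simp [hx]

theorem hangVal_nth_available (i : ℕ) : hangVal K V (Nat.nth (Available K V) i) = none :=
  (Nat.nth_mem_of_infinite (infinite_available K V) i).2.2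

theorem buildConfig_own_unique {e : ℕ} {sn : ℕ} {v w : P.Rep}
    (hv : sn ∈ (buildConfig P Op e K V).own v) (hw : sn ∈ (buildConfig P Op e K V).own w) :
    v = w := by
  rw [mem_buildConfig_own] at hv hw
  rcases hv with ⟨x, hx, rfl⟩ | ⟨i, hi, rfl⟩ <;> rcases hw with ⟨y, hy, rfl⟩ | ⟨j, hj, hij⟩
  · rw [Option.some.inj (hx.symm.trans hy)]
  · simp [← hij, hangVal_nth_available] at hx
  · simp [hangVal_nth_available] at hy
  · have heq := Nat.nth_injective (infinite_available K V) hij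
    rcases lt_trichotomy v w with hvw | hvw | hvw
    · exact absurd heq (sum_Iio_add_lt_sum_Iio_add hvw hi j).ne'
    · exact hvw
    · exact absurd heq (sum_Iio_add_lt_sum_Iio_add hvw hj i).ne

/-- `sn` is the first fresh sequence number of leader `v`: it follows the hanging ones `l₁`. -/
structure Config.FirstFresh (cfg : Config P Op) (v : P.Rep) (l₁ : List ℕ) (sn : ℕ)
    (l₂ : List ℕ) : Prop where
  own_eq : cfg.own v = l₁ ++ sn :: l₂
  hang_ne_none : ∀ x ∈ l₁, cfg.hang x ≠ none
  hang_eq_none : cfg.hang sn = none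

theorem buildConfig_exists_firstFresh (e : ℕ) (v : P.Rep) :
    ∃ l₁ sn l₂, (buildConfig P Op e K V).FirstFresh v l₁ sn l₂ := by
  obtain ⟨k, hk⟩ : ∃ k, freshCount K V e v = k + 1 :=
    Nat.exists_eq_add_one.2 (le_max_left 1 _)
  refine ⟨_, _, _, by rw [buildConfig_own, hk, List.range_succ_eq_map, List.map_cons],
    fun x hx => ?_, hangVal_nth_available K V _⟩
  rw [Finset.mem_sort, hangOwn, Finset.mem_filter] at hx
  exact (mem_hangSns K V).1 hx.1

theorem buildConfig_mem_own_of_hang {e : ℕ} {sn : ℕ} {r : Request Client Op}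
    (h : (buildConfig P Op e K V).hang sn = some (some r)) :
    sn ∈ (buildConfig P Op e K V).own ((buildConfig P Op e K V).bucket (P.hash r.client)) :=
  (mem_buildConfig_own K V).2 (Or.inl ⟨some r, h, rfl⟩)

end BuildConfig

/-- The properties of the configuration of epoch `e` on which liveness rests. -/
structure Config.Sound (cfg : Config P Op) (e : ℕ) : Prop where
  own_unique : ∀ {sn v w}, sn ∈ cfg.own v → sn ∈ cfg.own w → v = w
  exists_firstFresh : ∀ v, ∃ l₁ sn l₂, cfg.FirstFresh v l₁ sn l₂
  mem_own_of_hang : ∀ {sn r}, cfg.hang sn = some (some r) →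
    sn ∈ cfg.own (cfg.bucket (P.hash r.client))
  bucket_eq : cfg.bucket = P.rot e cfg.load
  Cmin_le_load : ∀ v, P.Cmin ≤ cfg.load v

theorem buildConfig_sound (e : ℕ) (K : Finset (ℕ × Config P Op)) (V : Finset (EpochChange P Op)) :
    (buildConfig P Op e K V).Sound e where
  own_unique := buildConfig_own_unique K V
  exists_firstFresh := buildConfig_exists_firstFresh K V e
  mem_own_of_hang := buildConfig_mem_own_of_hang K V
  bucket_eq := rfl
  Cmin_le_load := Cmin_le_loadOf K V e

theorem AtLeast.mono {q q' : ℕ} {S S' : P.Rep → Prop} (h : AtLeast P q S) (hq : q' ≤ q)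
    (hS : ∀ w, S w → S' w) : AtLeast P q' S' := by
  obtain ⟨W, hW, h⟩ := h
  exact ⟨W, hq.trans hW, fun w hw => hS w (h w hw)⟩

theorem update_eq_some_of_eq_some {α β : Type*} [DecidableEq α] {g : α → Option β} {a : α}
    (ha : g a = none) (y : β) (a' : α) (x : β) (hx : g a' = some x) :
    Function.update g a (some y) a' = some x := by
  rw [Function.update_of_ne, hx]
  rintro rfl
  simp [ha] at hx

/-! ### Receiving a message -/

namespace RState

variable (s : RState P Op) (t : ℝ) (src : Option P.Rep) (m : Msg P Op)

@[simp] theorem receive_epoch : (s.receive t src m).epoch = s.epoch := by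
  cases m <;> cases src <;> rfl

@[simp] theorem receive_active : (s.receive t src m).active = s.active := by
  cases m <;> cases src <;> rfl

@[simp] theorem receive_inbox : (s.receive t src m).inbox = insert (src, m) s.inbox := by
  cases m <;> cases src <;> rfl

@[simp] theorem receive_prepared : (s.receive t src m).prepared = s.prepared := by
  cases m <;> cases src <;> rfl

@[simp] theorem receive_cfg : (s.receive t src m).cfg = s.cfg := by
  cases m <;> cases src <;> rfl

@[simp] theorem receive_configs : (s.receive t src m).configs = s.configs := by
  cases m <;> cases src <;> rfl

@[simp] theorem receive_accepted : (s.receive t src m).accepted = s.accepted := by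
  cases m <;> cases src <;> rfl

@[simp] theorem receive_proposed : (s.receive t src m).proposed = s.proposed := by
  cases m <;> cases src <;> rfl

@[simp] theorem receive_call : (s.receive t src m).call = s.call := by
  cases m <;> cases src <;> rfl

@[simp] theorem receive_selected : (s.receive t src m).selected = s.selected := by
  cases m <;> cases src <;> rfl

@[simp] theorem receive_echoed : (s.receive t src m).echoed = s.echoed := by
  cases m <;> cases src <;> rfl

@[simp] theorem receive_readied : (s.receive t src m).readied = s.readied := by
  cases m <;> cases src <;> rfl

@[simp] theorem receive_epochTimer : (s.receive t src m).epochTimer = s.epochTimer := by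
  cases m <;> cases src <;> rfl

@[simp] theorem receive_changeTimer : (s.receive t src m).changeTimer = s.changeTimer := by
  cases m <;> cases src <;> rfl

theorem le_receive_progressTimer (v : P.Rep) :
    s.progressTimer v ≤ (s.receive t src m).progressTimer v := by
  cases m <;> cases src <;> try exact le_rfl
  all_goals
    simp only [receive]
    split_ifs <;> first | exact le_max_left _ _ | exact le_rfl

theorem queue_prefix_receive : s.queue <+: (s.receive t src m).queue := by
  cases m <;> cases src <;> try exact List.prefix_rfl
  all_goals
    simp only [receive]
    split_ifs
    · exact List.prefix_rfl
    · exact List.prefix_append _ _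

theorem certs_subset_receive : s.certs ⊆ (s.receive t src m).certs := by
  cases m <;> cases src <;> try exact subset_rfl
  all_goals
    simp only [receive]
    first | exact Finset.subset_insert _ _ | exact Finset.subset_union_left

theorem stable_subset_receive : s.stable ⊆ (s.receive t src m).stable := by
  cases m <;> cases src <;> try exact subset_rfl
  all_goals exact Finset.subset_insert _ _

theorem mem_receive_supplied {x : P.Rep × Finset (Entry Client Op)}
    (h : x ∈ (s.receive t src m).supplied) : x ∈ s.supplied ∨ x.2 = s.certs := by
  cases m <;> cases src <;> try exact Or.inl h
  all_goals
    simp only [receive, Finset.mem_insert] at h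
    rcases h with h | h
    all_goals simp [h]

/-- The statements for which a replica stores a combined signature, each given as the message that
carries the partial signatures. -/
def combined : Set (Msg P Op) :=
  {x | (∃ y ∈ s.configs, x = .ready y.1 y.2) ∨ (∃ c ∈ s.stable, x = .checkpoint c) ∨
    (∃ d ∈ s.prepared, x = .prepare d) ∨ ∃ d ∈ s.certs, x = .commit d}

theorem receive_combined_subset : (s.receive t src m).combined ⊆ s.combined ∪ m.combined := by
  intro x hx
  simp only [combined, receive_configs, receive_prepared, Set.mem_ofPred_eq] at hx
  rcases hx with h | ⟨c, hc, rfl⟩ | h | ⟨d, hd, rfl⟩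
  · exact Or.inl (Or.inl h)
  · cases m <;> cases src <;> try exact Or.inl (Or.inr (Or.inl ⟨c, hc, rfl⟩))
    all_goals
      rcases Finset.mem_insert.1 hc with rfl | hc
      · exact Or.inr rfl
      · exact Or.inl (Or.inr (Or.inl ⟨c, hc, rfl⟩))
  · exact Or.inl (Or.inr (Or.inr (Or.inl h)))
  · have stored (hd : d ∈ s.certs) : Msg.commit d ∈ s.combined :=
      Or.inr (Or.inr (Or.inr ⟨d, hd, rfl⟩))
    cases m with
    | commitCert d' =>
      rcases Finset.mem_insert.1 hd with rfl | hd
      · exact Or.inr rfl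
      · exact Or.inl (stored hd)
    | supply ds =>
      rcases Finset.mem_union.1 hd with hd | hd
      · exact Or.inl (stored hd)
      · exact Or.inr ⟨d, hd, rfl⟩
    | _ => cases src <;> exact Or.inl (stored hd)

/-! ### Evolution of the state of a replica -/

/-- What persists within an epoch. -/
structure SameEpoch (s s' : RState P Op) : Prop where
  selected : ∀ V, s.selected = some V → s'.selected = some V
  readied : ∀ cfg, s.readied = some cfg → s'.readied = some cfg
  active : s.active → s'.active
  accepted : s.active → ∀ sn x, s.accepted sn = some x → s'.accepted sn = some x
  proposed : s.active → ∀ sn r, s.proposed sn = some r → s'.proposed sn = some r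
  epochTimer : s.active → s'.epochTimer = s.epochTimer
  changeTimer : ∀ τ, s.changeTimer = some τ → s'.active ∨ s'.changeTimer = some τ

/-- What persists forever. -/
structure Evolves (s s' : RState P Op) : Prop where
  inbox : s.inbox ⊆ s'.inbox
  certs : s.certs ⊆ s'.certs
  stable : s.stable ⊆ s'.stable
  prepared : s.prepared ⊆ s'.prepared
  configs : s.configs ⊆ s'.configs
  queue : s.queue <+: s'.queue
  epoch : s.epoch ≤ s'.epoch
  same : s'.epoch = s.epoch → SameEpoch s s'

variable {s} {s' s'' : RState P Op} {u : P.Rep} {t}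

theorem SameEpoch.refl (s : RState P Op) : SameEpoch s s :=
  ⟨fun _ => id, fun _ => id, id, fun _ _ _ => id, fun _ _ _ => id, fun _ => rfl, fun _ => Or.inr⟩

theorem SameEpoch.trans (h : SameEpoch s s') (h' : SameEpoch s' s'') : SameEpoch s s'' where
  selected V hV := h'.selected V (h.selected V hV)
  readied c hc := h'.readied c (h.readied c hc)
  active ha := h'.active (h.active ha)
  accepted ha sn x hx := h'.accepted (h.active ha) sn x (h.accepted ha sn x hx)
  proposed ha sn x hx := h'.proposed (h.active ha) sn x (h.proposed ha sn x hx)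
  epochTimer ha := (h'.epochTimer (h.active ha)).trans (h.epochTimer ha)
  changeTimer τ hτ := (h.changeTimer τ hτ).elim (fun h => Or.inl (h'.active h))
    (h'.changeTimer τ)

theorem Evolves.refl (s : RState P Op) : Evolves s s :=
  ⟨subset_rfl, subset_rfl, subset_rfl, subset_rfl, subset_rfl, List.prefix_rfl, le_rfl,
    fun _ => .refl s⟩

theorem Evolves.trans (h : Evolves s s') (h' : Evolves s' s'') : Evolves s s'' where
  inbox := h.inbox.trans h'.inbox
  certs := h.certs.trans h'.certs
  stable := h.stable.trans h'.stable
  prepared := h.prepared.trans h'.prepared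
  configs := h.configs.trans h'.configs
  queue := h.queue.trans h'.queue
  epoch := h.epoch.trans h'.epoch
  same he := by
    have h1 := h.epoch
    have h2 := h'.epoch
    exact (h.same (by omega)).trans (h'.same (by omega))

theorem Evolves.combined (h : Evolves s s') : s.combined ⊆ s'.combined := by
  rintro _ (⟨y, hy, rfl⟩ | ⟨c, hc, rfl⟩ | ⟨d, hd, rfl⟩ | ⟨d, hd, rfl⟩)
  · exact Or.inl ⟨y, h.configs hy, rfl⟩
  · exact Or.inr (Or.inl ⟨c, h.stable hc, rfl⟩)
  · exact Or.inr (Or.inr (Or.inl ⟨d, h.prepared hd, rfl⟩))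
  · exact Or.inr (Or.inr (Or.inr ⟨d, h.certs hd, rfl⟩))

theorem evolves_receive (s : RState P Op) (t : ℝ) (src : Option P.Rep) (m : Msg P Op) :
    Evolves s (s.receive t src m) where
  inbox := by simp
  certs := certs_subset_receive ..
  stable := stable_subset_receive ..
  prepared := by simp
  configs := by simp
  queue := queue_prefix_receive ..
  epoch := by simp
  same _ := by constructor <;> simp +contextual

theorem evolves_callFor {e : ℕ} (he : s.epoch < e) : Evolves s (s.callFor u e) :=
  { Evolves.refl s with
    epoch := he.le
    same := fun h => absurd h he.ne' }

theorem evolves_enter (V : Finset (EpochChange P Op)) (ha : ¬ s.active) :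
    Evolves s (s.enter t V) :=
  { Evolves.refl s with
    certs := Finset.subset_union_left
    stable := Finset.subset_union_left
    configs := Finset.subset_insert _ _
    same := fun _ => { SameEpoch.refl s with
      active := fun h => absurd h ha
      accepted := fun h => absurd h ha
      proposed := fun h => absurd h ha
      epochTimer := fun h => absurd h ha
      changeTimer := fun _ _ => Or.inl trivial } }

theorem Act.evolves (h : Act u t s s') : Evolves s s' := by
  cases h with
  | callFinished | callExpired | callNoProgress | callNext =>
    exact evolves_callFor (Nat.lt_succ_self _)
  | callFollow e _ he => exact evolves_callFor he.1.1
  | propose sn r l₁ l₂ q₁ q₂ ha hown hl₁ hsn =>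
    exact { Evolves.refl s with same := fun _ => { SameEpoch.refl s with
      proposed := fun _ => update_eq_some_of_eq_some (by_contra fun h => hsn (Or.inr h)) r } }
  | acceptPrePrepare v d r l₁ l₂ ha hg he hacc =>
    exact { Evolves.refl s with same := fun _ => { SameEpoch.refl s with
      accepted := fun _ => update_eq_some_of_eq_some hacc d.val } }
  | acceptPrepared v d =>
    exact { Evolves.refl s with
      prepared := Finset.subset_insert _ _
      same := fun _ => { SameEpoch.refl s with } }
  | startTimer _ hn =>
    exact { Evolves.refl s with same := fun _ => { SameEpoch.refl s with
      changeTimer := by simp [hn] } }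
  | select V ha hp hn =>
    exact { Evolves.refl s with same := fun _ => { SameEpoch.refl s with
      selected := by simp [hn] } }
  | echo =>
    exact { Evolves.refl s with same := fun _ => { SameEpoch.refl s with } }
  | ready cfg hn =>
    exact { Evolves.refl s with same := fun _ => { SameEpoch.refl s with readied := by simp [hn] } }
  | enter V ha => exact evolves_enter V ha

end RState

/-! ### Local invariants -/

namespace RState

/-- How the current configuration was obtained. -/
def Entered (s : RState P Op) : Prop :=
  (s.epoch = 1 ∧ s.cfg = firstConfig P Op) ∨
    2 ≤ s.epoch ∧ ∃ V, s.Got (P.primary s.epoch) (.newEpoch s.epoch V) ∧ ValidV P s.epoch V ∧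
      s.Delivered s.cfg ∧ s.cfg = newConfig P s.epoch V

/-- The quorum on which `ready` is sent. -/
def ReadyQuorum (s : RState P Op) (cfg : Config P Op) : Prop :=
  AtLeast P (2 * P.f + 1) (fun w => s.Got w (.echo s.epoch cfg)) ∨
    AtLeast P (P.f + 1) (fun w => s.Got w (.ready s.epoch cfg))

variable {s s' : RState P Op} {u : P.Rep} {t : ℝ}

theorem Delivered.mono {cfg : Config P Op} (h : s.Delivered cfg) (hs : s.inbox ⊆ s'.inbox)
    (he : s'.epoch = s.epoch) : s'.Delivered cfg := by
  unfold Delivered at h ⊢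
  rw [he]
  exact h.mono le_rfl fun w hw => hs hw

theorem ReadyQuorum.mono {cfg : Config P Op} (h : s.ReadyQuorum cfg) (hs : s.inbox ⊆ s'.inbox)
    (he : s'.epoch = s.epoch) : s'.ReadyQuorum cfg := by
  unfold ReadyQuorum at h ⊢
  rw [he]
  exact h.imp (·.mono le_rfl fun w hw => hs hw) (·.mono le_rfl fun w hw => hs hw)

theorem Entered.mono (h : s.Entered) (hs : s.inbox ⊆ s'.inbox) (he : s'.epoch = s.epoch)
    (hc : s'.cfg = s.cfg) : s'.Entered := by
  unfold Entered at h ⊢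
  rw [he, hc]
  exact h.imp_right fun ⟨h2, V, hV, hvalid, hdel, heq⟩ =>
    ⟨h2, V, hs hV, hvalid, hdel.mono hs he, heq⟩

/-- The epoch of replica `u` and its epoch-change message. -/
structure EpochInv (u : P.Rep) (s : RState P Op) : Prop where
  one_le_epoch : 1 ≤ s.epoch
  two_le_epoch : ¬ s.active → 2 ≤ s.epoch
  call_ne_none : 2 ≤ s.epoch → s.call ≠ none
  of_call : ∀ c, s.call = some c → c.sender = u ∧ c.epoch = s.epoch ∧ c.combined ⊆ s.combined

/-- The grounds on which a replica takes part in the reliable broadcast and enters an epoch. -/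
structure BroadcastInv (s : RState P Op) : Prop where
  selected : ∀ V, s.selected = some V → ValidV P s.epoch V ∧
    ∀ c ∈ V, s.Got c.sender (.epochChange c)
  echoed : ∀ cfg, s.echoed = some cfg → s.Got (P.primary s.epoch) (.init s.epoch cfg)
  readied : ∀ cfg, s.readied = some cfg → s.ReadyQuorum cfg
  entered : s.active → s.Entered

/-- The requests that replica `u` has accepted and proposed in the current epoch. -/
structure OrderInv (u : P.Rep) (s : RState P Op) : Prop where
  accepted_of_hang : s.active → ∀ sn x, s.cfg.hang sn = some x → s.accepted sn = some x
  of_accepted : s.active → ∀ sn x, s.accepted sn = some x → s.cfg.hang sn = some x ∨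
    ∃ v, sn ∈ s.cfg.own v ∧ s.Got v (.prePrepare ⟨s.epoch, sn, x⟩)
  of_proposed : s.active → ∀ sn, s.proposed sn ≠ none →
    ∃ l₁ l₂, s.cfg.own u = l₁ ++ sn :: l₂ ∧ (∀ x ∈ l₁, s.Used x) ∧ s.cfg.hang sn = none

/-- Received certificates and requests are stored. -/
structure StoreInv (s : RState P Op) : Prop where
  supplied : ∀ x ∈ s.supplied, x.2 ⊆ s.certs
  commitCert : ∀ src d, (src, Msg.commitCert d) ∈ s.inbox → d ∈ s.certs
  supply : ∀ src ds, (src, Msg.supply ds) ∈ s.inbox → ds ⊆ s.certs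
  checkpointCert : ∀ src c, (src, Msg.checkpointCert c) ∈ s.inbox → c ∈ s.stable
  request : ∀ src r, (src, Msg.request r) ∈ s.inbox → r ∈ s.queue

theorem EpochInv.start (u : P.Rep) : EpochInv u (RState.start P Op) := by
  constructor <;> simp [RState.start]

theorem EpochInv.receive (h : EpochInv u s) (t : ℝ) (src : Option P.Rep) (m : Msg P Op) :
    EpochInv u (s.receive t src m) := by
  have hcombined := (evolves_receive s t src m).combined
  constructor <;> simp only [receive_epoch, receive_active, receive_call]
  · exact h.one_le_epoch
  · exact h.two_le_epoch
  · exact h.call_ne_none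
  · exact fun c hc => (h.of_call c hc).imp_right (And.imp_right (·.trans hcombined))

theorem callFor_call_combined_subset {e : ℕ} {c : EpochChange P Op}
    (hc : (s.callFor u e).call = some c) : c.combined ⊆ s.combined := by
  simp only [callFor, Option.some.injEq] at hc
  subst hc
  rintro x (h | h | ⟨d, hd, rfl⟩ | ⟨d, hd, rfl⟩)
  · exact Or.inl h
  · exact Or.inr (Or.inl h)
  · exact Or.inr (Or.inr (Or.inl ⟨d, (Finset.mem_filter.1 hd).1, rfl⟩))
  · exact Or.inr (Or.inr (Or.inr ⟨d, (Finset.mem_filter.1 hd).1, rfl⟩))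

theorem EpochInv.callFor (h : EpochInv u s) {e : ℕ} (he : s.epoch < e) :
    EpochInv u (s.callFor u e) where
  one_le_epoch := h.one_le_epoch.trans he.le
  two_le_epoch _ := h.one_le_epoch.trans_lt he
  call_ne_none _ := Option.some_ne_none _
  of_call c hc := by
    have hsub := callFor_call_combined_subset hc
    cases hc
    exact ⟨rfl, rfl, hsub⟩

theorem EpochInv.act (h : EpochInv u s) (ha : Act u t s s') : EpochInv u s' := by
  have hcombined := ha.evolves.combined
  cases ha with
  | callFinished | callExpired | callNoProgress | callNext => exact h.callFor (Nat.lt_succ_self _)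
  | callFollow e _ he => exact h.callFor he.1.1
  | enter V ha hg hV hd =>
    exact { h with
      two_le_epoch := fun hn => absurd trivial hn
      of_call := fun c hc => (h.of_call c hc).imp_right (And.imp_right (·.trans hcombined)) }
  | _ => exact { h with
      of_call := fun c hc => (h.of_call c hc).imp_right (And.imp_right (·.trans hcombined)) }

theorem BroadcastInv.start : BroadcastInv (RState.start P Op) := by
  constructor <;> simp [RState.start, Entered]

theorem BroadcastInv.receive (h : BroadcastInv s) (t : ℝ) (src : Option P.Rep) (m : Msg P Op) :
    BroadcastInv (s.receive t src m) := by
  have hinbox := (evolves_receive s t src m).inbox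
  have hepoch := receive_epoch s t src m
  constructor <;>
    simp only [hepoch, receive_active, receive_selected, receive_echoed, receive_readied]
  · exact fun V hV => (h.selected V hV).imp_right fun hgot c hc => hinbox (hgot c hc)
  · exact fun cfg hc => hinbox (h.echoed cfg hc)
  · exact fun cfg hc => (h.readied cfg hc).mono hinbox hepoch
  · exact fun ha => (h.entered ha).mono hinbox hepoch (receive_cfg ..)

theorem BroadcastInv.callFor (u : P.Rep) (e : ℕ) : BroadcastInv (s.callFor u e) := by
  constructor <;> simp [RState.callFor]

theorem BroadcastInv.act (h : BroadcastInv s) (h2 : ¬ s.active → 2 ≤ s.epoch)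
    (ha : Act u t s s') : BroadcastInv s' := by
  cases ha with
  | callFinished | callExpired | callNoProgress | callNext | callFollow =>
    exact BroadcastInv.callFor u _
  | select V ha hp hn hV hgot => exact { h with selected := by rintro _ ⟨⟩; exact ⟨hV, hgot⟩ }
  | echo cfg hn hg => exact { h with echoed := by rintro _ ⟨⟩; exact hg }
  | ready cfg hn hg => exact { h with readied := by rintro _ ⟨⟩; exact hg }
  | enter V ha hg hV hd =>
    exact { h with entered := fun _ => Or.inr ⟨h2 ha, V, hg, hV, hd, rfl⟩ }
  | _ => exact { h with }

theorem OrderInv.start (u : P.Rep) : OrderInv u (RState.start P Op) where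
  accepted_of_hang _ _ _ hx := hx
  of_accepted _ _ _ hx := Or.inl hx
  of_proposed _ _ hsn := absurd rfl hsn

theorem OrderInv.receive (h : OrderInv u s) (t : ℝ) (src : Option P.Rep) (m : Msg P Op) :
    OrderInv u (s.receive t src m) := by
  have hinbox := (evolves_receive s t src m).inbox
  constructor <;> simp only [receive_epoch, receive_active, receive_accepted, receive_proposed,
    receive_cfg, Used]
  · exact h.accepted_of_hang
  · exact fun ha sn x hx => (h.of_accepted ha sn x hx).imp_right
      fun ⟨v, hv, hg⟩ => ⟨v, hv, hinbox hg⟩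
  · exact h.of_proposed

theorem OrderInv.callFor (e : ℕ) : OrderInv u (s.callFor u e) where
  accepted_of_hang := False.elim
  of_accepted := False.elim
  of_proposed := False.elim

theorem OrderInv.propose (h : OrderInv u s) (ha : s.active) {sn : ℕ} {l₁ l₂ : List ℕ}
    (hown : s.cfg.own u = l₁ ++ sn :: l₂) (hl₁ : ∀ x ∈ l₁, s.Used x) (hsn : ¬ s.Used sn)
    (r : Request Client Op) :
    OrderInv u { s with proposed := Function.update s.proposed sn (some r) } := by
  have used_mono : ∀ x, s.Used x →
      RState.Used { s with proposed := Function.update s.proposed sn (some r) } x := by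
    refine fun x => Or.imp_right fun hx => ?_
    simp only [Function.update_apply]
    split_ifs
    · simp
    · exact hx
  refine { h with of_proposed := fun _ sn' hsn' => ?_ }
  by_cases heq : sn' = sn
  · subst heq
    exact ⟨l₁, l₂, hown, fun x hx => used_mono x (hl₁ x hx),
      by_contra fun hne => hsn (Or.inl hne)⟩
  · simp only [Function.update_of_ne heq] at hsn'
    obtain ⟨l₁', l₂', hown', hused, hhang⟩ := h.of_proposed ha sn' hsn'
    exact ⟨l₁', l₂', hown', fun x hx => used_mono x (hused x hx), hhang⟩

theorem OrderInv.accept (h : OrderInv u s) (ha : s.active) {v : P.Rep} {d : Entry Client Op}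
    (hgot : s.Got v (.prePrepare d)) (he : d.epoch = s.epoch) (hnone : s.accepted d.sn = none)
    (hown : d.sn ∈ s.cfg.own v) :
    OrderInv u { s with accepted := Function.update s.accepted d.sn (some d.val) } := by
  refine { h with
    accepted_of_hang := fun _ sn x hx =>
      update_eq_some_of_eq_some hnone d.val sn x (h.accepted_of_hang ha sn x hx)
    of_accepted := fun _ sn x hx => ?_ }
  simp only [Function.update_apply] at hx
  split_ifs at hx with heq
  · cases hx
    subst heq
    exact Or.inr ⟨v, hown, he ▸ hgot⟩
  · exact h.of_accepted ha sn x hx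

theorem OrderInv.act (h : OrderInv u s) (ha : Act u t s s') : OrderInv u s' := by
  cases ha with
  | callFinished | callExpired | callNoProgress | callNext | callFollow => exact OrderInv.callFor _
  | propose sn r l₁ l₂ q₁ q₂ ha hown hl₁ hsn => exact h.propose ha hown hl₁ hsn r
  | acceptPrePrepare v d r l₁ l₂ ha hg he hnone hown =>
    exact h.accept ha hg he hnone (by simp [hown])
  | enter V ha hg hV hd =>
    exact ⟨fun _ _ _ hx => hx, fun _ _ _ hx => Or.inl hx, fun _ _ hsn => absurd rfl hsn⟩
  | _ => exact { h with }

theorem StoreInv.start : StoreInv (RState.start P Op) := by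
  constructor <;> simp [RState.start]

theorem StoreInv.receive (h : StoreInv s) (t : ℝ) (src : Option P.Rep) (m : Msg P Op) :
    StoreInv (s.receive t src m) := by
  have hev := evolves_receive s t src m
  constructor
  case supplied =>
    intro x hx
    rcases mem_receive_supplied _ _ _ _ hx with hx | hx
    · exact (h.supplied x hx).trans hev.certs
    · exact hx ▸ hev.certs
  all_goals simp only [receive_inbox, Finset.mem_insert, Prod.mk.injEq]
  · rintro src' d (⟨rfl, rfl⟩ | hd)
    · exact Finset.mem_insert_self _ _
    · exact hev.certs (h.commitCert _ _ hd)
  · rintro src' ds (⟨rfl, rfl⟩ | hds)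
    · exact Finset.subset_union_right
    · exact (h.supply _ _ hds).trans hev.certs
  · rintro src' c (⟨rfl, rfl⟩ | hc)
    · exact Finset.mem_insert_self _ _
    · exact hev.stable (h.checkpointCert _ _ hc)
  · rintro src' r (⟨rfl, rfl⟩ | hr)
    · simp only [RState.receive]
      split_ifs with hmem
      · exact hmem
      · simp
    · exact hev.queue.subset (h.request _ _ hr)

theorem StoreInv.act (h : StoreInv s) (ha : Act u t s s') : StoreInv s' := by
  cases ha with
  | enter V =>
    exact { h with
      supplied := fun x hx => (h.supplied x hx).trans Finset.subset_union_left
      commitCert := fun src d hd => Finset.mem_union_left _ (h.commitCert src d hd)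
      supply := fun src d hd => (h.supply src d hd).trans Finset.subset_union_left
      checkpointCert := fun src c hc => Finset.mem_union_left _ (h.checkpointCert src c hc) }
  | _ => exact { h with }

/-- The invariants of a replica `u` that follows the protocol. -/
structure Inv (u : P.Rep) (s : RState P Op) : Prop
    extends EpochInv u s, BroadcastInv s, OrderInv u s, StoreInv s

theorem Inv.start (u : P.Rep) : Inv u (RState.start P Op) :=
  ⟨.start u, .start, .start u, .start⟩

theorem Inv.receive (h : Inv u s) (t : ℝ) (src : Option P.Rep) (m : Msg P Op) :
    Inv u (s.receive t src m) :=
  ⟨h.toEpochInv.receive t src m, h.toBroadcastInv.receive t src m, h.toOrderInv.receive t src m,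
    h.toStoreInv.receive t src m⟩

theorem Inv.act (h : Inv u s) (ha : Act u t s s') : Inv u s' :=
  ⟨h.toEpochInv.act ha, h.toBroadcastInv.act h.two_le_epoch ha, h.toOrderInv.act ha,
    h.toStoreInv.act ha⟩

end RState

/-! ### What a sent message says about its sender -/

namespace RState

variable {s s' : RState P Op} {u w : P.Rep} {t : ℝ}

theorem Sends.prePrepare_inv {d : Entry Client Op} (h : s.Sends u w (.prePrepare d)) :
    s.active ∧ d.epoch = s.epoch ∧ ∃ r, d.val = some r ∧ s.proposed d.sn = some r := by
  cases h
  exact ⟨‹_›, rfl, _, rfl, ‹_›⟩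

theorem Sends.preparedCert_inv {d : Entry Client Op} (h : s.Sends u w (.preparedCert d)) :
    s.active ∧ d.epoch = s.epoch ∧ s.accepted d.sn = some d.val := by
  cases h
  exact ⟨‹_›, ‹_›, ‹_›⟩

theorem Sends.commit_inv {d : Entry Client Op} (h : s.Sends u w (.commit d)) :
    s.active ∧ d.epoch = s.epoch ∧ d ∈ s.prepared := by
  cases h
  exact ⟨‹_›, ‹_›, ‹_›⟩

theorem Sends.checkpoint_inv {c : Ckpt P Op} (h : s.Sends u w (.checkpoint c)) :
    s.active ∧ c.epoch = s.epoch ∧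
      List.Forall₂ (fun sn y => y.1 = sn ∧ (⟨s.epoch, sn, y.2⟩ : Entry Client Op) ∈ s.certs)
        ((s.cfg.own c.leader).take c.log.length) c.log := by
  cases h
  exact ⟨‹_›, ‹_›, ‹_›⟩

theorem Sends.epochChange_inv {c : EpochChange P Op} (h : s.Sends u w (.epochChange c)) :
    s.call = some c := by
  cases h
  assumption

theorem Sends.init_inv {e : ℕ} {cfg : Config P Op} (h : s.Sends u w (.init e cfg)) :
    e = s.epoch ∧ ∃ V, s.selected = some V ∧ cfg = newConfig P s.epoch V := by
  cases h
  exact ⟨rfl, _, ‹_›, rfl⟩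

theorem Sends.echo_inv {e : ℕ} {cfg : Config P Op} (h : s.Sends u w (.echo e cfg)) :
    e = s.epoch ∧ s.echoed = some cfg := by
  cases h
  exact ⟨rfl, ‹_›⟩

theorem Sends.ready_inv {e : ℕ} {cfg : Config P Op} (h : s.Sends u w (.ready e cfg)) :
    e = s.epoch ∧ s.readied = some cfg := by
  cases h
  exact ⟨rfl, ‹_›⟩

theorem Sends.newEpoch_inv {e : ℕ} {V : Finset (EpochChange P Op)}
    (h : s.Sends u w (.newEpoch e V)) : e = s.epoch ∧ s.selected = some V := by
  cases h
  exact ⟨rfl, ‹_›⟩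

theorem Sends.fetch_inv {e : ℕ} (h : s.Sends u w (.fetch e)) : e = s.epoch := by
  cases h
  rfl

/-- The replica stores or has received a combined signature for `x`, or partial signatures for `x`
of `2f+1` replicas. -/
def Backed (s : RState P Op) (x : Msg P Op) : Prop :=
  x ∈ s.combined ∨ (∃ v m, s.Got v m ∧ x ∈ m.combined) ∨ AtLeast P (2 * P.f + 1) (s.Got · x)

theorem Sends.backed {m x : Msg P Op} (h : s.Sends u w m) (hinv : Inv u s)
    (hx : x ∈ m.combined) : s.Backed x := by
  cases h with
  | preparedCert | commitCert | checkpointCert =>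
    cases hx
    exact Or.inr (Or.inr ‹_›)
  | epochChange _ c hc => exact Or.inl ((hinv.of_call c hc).2.2 hx)
  | newEpoch _ V hV =>
    obtain ⟨c, hc, hx⟩ := hx
    exact Or.inr (Or.inl ⟨_, _, (hinv.selected V hV).2 c hc, hx⟩)
  | supply _ ds hds =>
    obtain ⟨d, hd, rfl⟩ := hx
    exact Or.inl (Or.inr (Or.inr (Or.inr ⟨d, hinv.supplied _ hds hd, rfl⟩)))
  | _ => cases hx

theorem Act.backed {x : Msg P Op} (h : Act u t s s') (hx : x ∈ s'.combined) : s.Backed x := by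
  cases h with
  | acceptPrepared v d ha hg =>
    rcases hx with hx | hx | ⟨d', hd', rfl⟩ | hx
    · exact Or.inl (Or.inl hx)
    · exact Or.inl (Or.inr (Or.inl hx))
    · rcases Finset.mem_insert.1 hd' with rfl | hd'
      · exact Or.inr (Or.inl ⟨v, _, hg, rfl⟩)
      · exact Or.inl (Or.inr (Or.inr (Or.inl ⟨d', hd', rfl⟩)))
    · exact Or.inl (Or.inr (Or.inr (Or.inr hx)))
  | enter V ha hg hV hd =>
    have of_mem {c} (hc : c ∈ V) (hx : x ∈ c.combined) : s.Backed x :=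
      Or.inr (Or.inl ⟨_, _, hg, c, hc, hx⟩)
    rcases hx with ⟨y, hy, rfl⟩ | ⟨c, hc, rfl⟩ | hx | ⟨d, hd, rfl⟩
    · rcases Finset.mem_insert.1 hy with rfl | hy
      · exact Or.inr (Or.inr hd)
      · exact Or.inl (Or.inl ⟨y, hy, rfl⟩)
    · rcases Finset.mem_union.1 hc with hc | hc
      · exact Or.inl (Or.inr (Or.inl ⟨c, hc, rfl⟩))
      · obtain ⟨a, ha, hc⟩ := Finset.mem_biUnion.1 hc
        exact of_mem ha (Or.inr (Or.inl ⟨c, hc, rfl⟩))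
    · exact Or.inl (Or.inr (Or.inr (Or.inl hx)))
    · rcases Finset.mem_union.1 hd with hd | hd
      · exact Or.inl (Or.inr (Or.inr (Or.inr ⟨d, hd, rfl⟩)))
      · obtain ⟨a, ha, hd⟩ := Finset.mem_biUnion.1 hd
        exact of_mem ha (Or.inr (Or.inr (Or.inr ⟨d, hd, rfl⟩)))
  | _ => exact Or.inl hx

theorem Act.inbox_eq (h : Act u t s s') : s'.inbox = s.inbox := by
  cases h <;> rfl

theorem Act.mem_prepared (h : Act u t s s') {d : Entry Client Op} (hd : d ∈ s'.prepared) :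
    d ∈ s.prepared ∨
      s.active ∧ d.epoch = s.epoch ∧ ∃ v, s.Got v (.preparedCert d) ∧ d.sn ∈ s.cfg.own v := by
  cases h with
  | acceptPrepared v d' ha hg he hsn =>
    rcases Finset.mem_insert.1 hd with rfl | hd
    · exact Or.inr ⟨ha, he, v, hg, hsn⟩
    · exact Or.inl hd
  | _ => exact Or.inl hd

/-- In state `s`, leader `u` performs the action of proposing `r` with sequence number `sn`. -/
structure Proposes (s : RState P Op) (u : P.Rep) (sn : ℕ) (r : Request Client Op) : Prop where
  active : s.active
  fresh : ¬ s.Used sn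
  first : ∃ q₁ q₂, s.queue = q₁ ++ r :: q₂ ∧ ∀ x ∈ q₁, ¬ s.Eligible u x
  eligible : s.Eligible u r

theorem Act.proposed (h : Act u t s s') {sn : ℕ} {r : Request Client Op}
    (hr : s'.proposed sn = some r) :
    s'.epoch = s.epoch ∧ (s.proposed sn = some r ∨ s.Proposes u sn r) := by
  cases h with
  | propose sn' r' l₁ l₂ q₁ q₂ ha hown hl₁ hsn hlow hq hq₁ hel =>
    simp only [Function.update_apply] at hr
    split_ifs at hr with heq
    · cases hr
      subst heq
      exact ⟨rfl, Or.inr ⟨ha, hsn, ⟨q₁, q₂, hq, hq₁⟩, hel⟩⟩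
    · exact ⟨rfl, Or.inl hr⟩
  | callFinished | callExpired | callNoProgress | callNext | callFollow | enter => cases hr
  | _ => exact ⟨rfl, Or.inl hr⟩

end RState

/-! ### Quorums -/

section Quorum

variable {byz : Finset P.Rep}

theorem exists_correct (hbyz : byz.card ≤ P.f) {W : Finset P.Rep} (hW : P.f + 1 ≤ W.card) :
    ∃ w ∈ W, w ∉ byz :=
  Finset.exists_mem_notMem_of_card_lt_card (by omega)

theorem AtLeast.exists_correct (hbyz : byz.card ≤ P.f) {q : ℕ} {S : P.Rep → Prop}
    (h : AtLeast P q S) (hq : P.f + 1 ≤ q) : ∃ w, w ∉ byz ∧ S w := by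
  obtain ⟨W, hW, hS⟩ := h
  obtain ⟨w, hw, hb⟩ := FnF.exists_correct hbyz (hq.trans hW)
  exact ⟨w, hb, hS w hw⟩

theorem le_card_compl (hbyz : byz.card ≤ P.f) : 2 * P.f + 1 ≤ byzᶜ.card := by
  rw [Finset.card_compl, Fintype.card_fin]
  omega

theorem atLeast_of_correct (hbyz : byz.card ≤ P.f) {q : ℕ} (hq : q ≤ 2 * P.f + 1)
    {S : P.Rep → Prop} (h : ∀ w, w ∉ byz → S w) : AtLeast P q S :=
  ⟨byzᶜ, hq.trans (le_card_compl hbyz), fun w hw => h w (Finset.mem_compl.1 hw)⟩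

theorem AtLeast.and_correct (hbyz : byz.card ≤ P.f) {S : P.Rep → Prop}
    (h : AtLeast P (2 * P.f + 1) S) : AtLeast P (P.f + 1) (fun w => w ∉ byz ∧ S w) := by
  obtain ⟨W, hW, hS⟩ := h
  refine ⟨W \ byz, ?_, fun w hw => ?_⟩
  · have := Finset.le_card_sdiff byz W
    omega
  · rw [Finset.mem_sdiff] at hw
    exact ⟨hw.2, hS w hw.1⟩

theorem AtLeast.exists_correct_and (hbyz : byz.card ≤ P.f) {S S' : P.Rep → Prop}
    (h : AtLeast P (2 * P.f + 1) S) (h' : AtLeast P (2 * P.f + 1) S') :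
    ∃ w, w ∉ byz ∧ S w ∧ S' w := by
  obtain ⟨W, hW, hS⟩ := h
  obtain ⟨W', hW', hS'⟩ := h'
  have hadd := Finset.card_union_add_card_inter W W'
  have hunion : (W ∪ W').card ≤ 3 * P.f + 1 := by
    simpa using Finset.card_le_univ (W ∪ W')
  obtain ⟨w, hw, hb⟩ := FnF.exists_correct hbyz (W := W ∩ W') (by omega)
  rw [Finset.mem_inter] at hw
  exact ⟨w, hb, hS w hw.1, hS' w hw.2⟩

end Quorum

/-! ### Executions -/

theorem exists_lt_not_and_succ {p : ℕ → Prop} {i : ℕ} (h0 : ¬ p 0) (hi : p i) :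
    ∃ j < i, ¬ p j ∧ p (j + 1) := by
  induction i with
  | zero => exact absurd hi h0
  | succ i ih =>
    by_cases h : p i
    · obtain ⟨j, hj, hp⟩ := ih h
      exact ⟨j, hj.trans i.lt_succ_self, hp⟩
    · exact ⟨i, i.lt_succ_self, h, hi⟩

namespace Execution

variable {byz : Finset P.Rep} {good : Set Client} (E : Execution P Op byz good)

theorem step (i : ℕ) (u : P.Rep) : E.state (i + 1) u = E.state i u ∨
    (∃ src m, E.event i = .deliver src u m ∧
      E.state (i + 1) u = (E.state i u).receive (E.time (i + 1)) src m) ∨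
    RState.Act u (E.time (i + 1)) (E.state i u) (E.state (i + 1) u) := by
  cases h : E.event i with
  | submit r => exact Or.inl (congrFun (E.on_other i (Or.inr ⟨r, h⟩)) u)
  | idle => exact Or.inl (congrFun (E.on_other i (Or.inl h)) u)
  | deliver src dst m =>
    obtain ⟨hdst, hother⟩ := E.on_deliver i src dst m h
    by_cases hu : u = dst
    · subst hu
      exact Or.inr (Or.inl ⟨src, m, rfl, hdst⟩)
    · exact Or.inl (hother u hu)
  | act w =>
    obtain ⟨hact, hother⟩ := E.on_act i w h
    by_cases hu : u = w
    · subst hu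
      exact Or.inr (Or.inr hact)
    · exact Or.inl (hother u hu)

theorem inv (i : ℕ) (u : P.Rep) : RState.Inv u (E.state i u) := by
  induction i with
  | zero => exact E.start u ▸ .start u
  | succ i ih =>
    rcases E.step i u with h | ⟨src, m, -, h⟩ | h
    · rwa [h]
    · exact h ▸ ih.receive ..
    · exact ih.act h

theorem evolves {i j : ℕ} (hij : i ≤ j) (u : P.Rep) : (E.state i u).Evolves (E.state j u) := by
  induction j, hij using Nat.le_induction with
  | base => exact .refl _
  | succ j _ ih =>
    refine ih.trans ?_
    rcases E.step j u with h | ⟨src, m, -, h⟩ | h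
    · exact h ▸ .refl _
    · exact h ▸ RState.evolves_receive ..
    · exact h.evolves

theorem epoch_mono {i j : ℕ} (hij : i ≤ j) (u : P.Rep) :
    (E.state i u).epoch ≤ (E.state j u).epoch := (E.evolves hij u).epoch

theorem sameEpoch_total {i j : ℕ} {u : P.Rep} (h : (E.state i u).epoch = (E.state j u).epoch) :
    (E.state i u).SameEpoch (E.state j u) ∨ (E.state j u).SameEpoch (E.state i u) :=
  (le_total i j).imp (fun hij => (E.evolves hij u).same h.symm)
    fun hij => (E.evolves hij u).same h

theorem exists_step_of_change {p : RState P Op → Prop} {i : ℕ} {u : P.Rep}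
    (h0 : ¬ p (.start P Op)) (hi : p (E.state i u)) :
    ∃ j < i, ¬ p (E.state j u) ∧ p (E.state (j + 1) u) ∧
      ((∃ src m, E.event j = .deliver src u m ∧
        E.state (j + 1) u = (E.state j u).receive (E.time (j + 1)) src m) ∨
      RState.Act u (E.time (j + 1)) (E.state j u) (E.state (j + 1) u)) := by
  obtain ⟨j, hj, hn, hp⟩ := exists_lt_not_and_succ (p := fun i => p (E.state i u))
    (by rwa [E.start]) hi
  exact ⟨j, hj, hn, hp, (E.step j u).resolve_left fun h => hn (h ▸ hp)⟩

theorem deliver_of_mem_inbox {i : ℕ} {u : P.Rep} {src : Option P.Rep} {m : Msg P Op}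
    (h : (src, m) ∈ (E.state i u).inbox) : ∃ j < i, E.event j = .deliver src u m := by
  obtain ⟨j, hj, hn, hmem, ⟨src', m', he, hs⟩ | hact⟩ :=
    E.exists_step_of_change (p := fun s => (src, m) ∈ s.inbox) (Finset.notMem_empty _) h
  · rw [hs, RState.receive_inbox] at hmem
    obtain ⟨rfl, rfl⟩ := Prod.mk.inj ((Finset.mem_insert.1 hmem).resolve_right hn)
    exact ⟨j, hj, he⟩
  · exact absurd (hact.inbox_eq ▸ hmem) hn

theorem mem_inbox_of_deliver {i j : ℕ} (hij : i < j) {u : P.Rep} {src : Option P.Rep}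
    {m : Msg P Op} (h : E.event i = .deliver src u m) : (src, m) ∈ (E.state j u).inbox := by
  refine (E.evolves (Nat.succ_le_of_lt hij) u).inbox ?_
  rw [(E.on_deliver i src u m h).1, RState.receive_inbox]
  exact Finset.mem_insert_self _ _

theorem sends_of_got {i : ℕ} {u w : P.Rep} {m : Msg P Op} (hw : w ∉ byz)
    (h : (E.state i u).Got w m) : ∃ j < i, (E.state j w).Sends w u m := by
  obtain ⟨k, hk, he⟩ := E.deliver_of_mem_inbox h
  obtain ⟨j, hj, hs⟩ := E.authentic k w u m he hw
  exact ⟨j, hj.trans_lt hk, hs⟩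

/-! ### Combined signatures are genuine -/

/-- The statement `x` was signed, before the `i`-th step, by the correct ones among `2f+1`
replicas. -/
def Supported (i : ℕ) (x : Msg P Op) : Prop :=
  ∃ U : Finset P.Rep, U.card = 2 * P.f + 1 ∧
    ∀ w ∈ U, w ∉ byz → ∃ j ≤ i, ∃ z, (E.state j w).Sends w z x

variable {E}

theorem Supported.mono {i j : ℕ} {x : Msg P Op} (h : E.Supported i x) (hij : i ≤ j) :
    E.Supported j x := by
  obtain ⟨U, hU, h⟩ := h
  refine ⟨U, hU, fun w hw hb => ?_⟩
  obtain ⟨k, hk, hs⟩ := h w hw hb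
  exact ⟨k, hk.trans hij, hs⟩

theorem Supported.exists_sends (hbyz : byz.card ≤ P.f) {i : ℕ} {x : Msg P Op}
    (h : E.Supported i x) : ∃ w, w ∉ byz ∧ ∃ j ≤ i, ∃ z, (E.state j w).Sends w z x := by
  obtain ⟨U, hU, h⟩ := h
  obtain ⟨w, hw, hb⟩ := exists_correct hbyz (W := U) (by omega)
  exact ⟨w, hb, h w hw hb⟩

theorem supported_of_atLeast {i : ℕ} {u : P.Rep} {x : Msg P Op}
    (h : AtLeast P (2 * P.f + 1) ((E.state i u).Got · x)) : E.Supported i x := by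
  obtain ⟨W, hW, h⟩ := h
  obtain ⟨U, hUW, hU⟩ := Finset.exists_subset_card_eq hW
  refine ⟨U, hU, fun w hw hb => ?_⟩
  obtain ⟨j, hj, hs⟩ := E.sends_of_got hb (h w (hUW hw))
  exact ⟨j, hj.le, u, hs⟩

theorem supported_of_backed {i : ℕ} {u : P.Rep} {x : Msg P Op} (h : (E.state i u).Backed x) :
    E.Supported i x := by
  induction i using Nat.strong_induction_on generalizing u with
  | _ i ih =>
    have of_got {v m} (hg : (E.state i u).Got v m) (hx : x ∈ m.combined) : E.Supported i x := by
      by_cases hv : v ∈ byz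
      · obtain ⟨k, hk, he⟩ := E.deliver_of_mem_inbox hg
        have h : E.Supported k x := (E.unforgeable k v u m he hv).2 x hx
        exact h.mono hk.le
      · obtain ⟨j, hj, hs⟩ := E.sends_of_got hv hg
        exact (ih j hj (hs.backed (E.inv j v) hx)).mono hj.le
    rcases h with hx | ⟨v, m, hg, hx⟩ | hq
    · have h0 : x ∉ (RState.start P Op).combined := by simp [RState.combined, RState.start]
      obtain ⟨j, hj, hn, hx', ⟨src, m, he, hs⟩ | hact⟩ :=
        E.exists_step_of_change (p := (x ∈ ·.combined)) h0 hx
      · rw [hs] at hx'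
        have hxm : x ∈ m.combined := (RState.receive_combined_subset _ _ _ _ hx').resolve_left hn
        cases src with
        | none =>
          obtain ⟨r, rfl⟩ := E.from_client j u m he
          cases hxm
        | some v => exact of_got (E.mem_inbox_of_deliver hj he) hxm
      · exact (ih j hj (hact.backed hx')).mono hj.le
    · exact of_got hg hx
    · exact supported_of_atLeast hq

theorem supported_of_mem_certs {i : ℕ} {u : P.Rep} {d : Entry Client Op}
    (h : d ∈ (E.state i u).certs) : E.Supported i (.commit d) :=
  supported_of_backed (Or.inl (Or.inr (Or.inr (Or.inr ⟨d, h, rfl⟩))))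

theorem supported_of_mem_stable {i : ℕ} {u : P.Rep} {c : Ckpt P Op}
    (h : c ∈ (E.state i u).stable) : E.Supported i (.checkpoint c) :=
  supported_of_backed (Or.inl (Or.inr (Or.inl ⟨c, h, rfl⟩)))

variable (E)

/-! ### Agreement on the configurations -/

/-- At step `i`, replica `u` takes part in epoch `e`. -/
structure InEpoch (e i : ℕ) (u : P.Rep) : Prop where
  active : (E.state i u).active
  epoch_eq : (E.state i u).epoch = e

/-- The configuration of epoch `e`: the one with which a correct replica enters `e`. If there is no
such replica, the value is irrelevant, but still a configuration that the protocol computes. -/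
def config (e : ℕ) : Config P Op :=
  if h : ∃ x : ℕ × P.Rep, x.2 ∉ byz ∧ E.InEpoch e x.1 x.2 then
    (E.state h.choose.1 h.choose.2).cfg
  else buildConfig P Op e ∅ ∅

variable {E}

theorem InEpoch.sound {e i : ℕ} {u : P.Rep} (h : E.InEpoch e i u) :
    (E.state i u).cfg.Sound e := by
  obtain ⟨ha, rfl⟩ := h
  rcases (E.inv i u).entered ha with ⟨he, hc⟩ | ⟨-, V, -, -, -, hc⟩
  · rw [he, hc]
    exact buildConfig_sound ..
  · rw [hc]
    exact buildConfig_sound ..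

variable (E) in
theorem config_sound (e : ℕ) : (E.config e).Sound e := by
  unfold config
  split_ifs with h
  · exact h.choose_spec.2.sound
  · exact buildConfig_sound ..

theorem readied_unique {i j : ℕ} {u : P.Rep} {cfg cfg' : Config P Op}
    (he : (E.state i u).epoch = (E.state j u).epoch) (h : (E.state i u).readied = some cfg)
    (h' : (E.state j u).readied = some cfg') : cfg = cfg' := by
  rcases E.sameEpoch_total he with hs | hs
  · exact Option.some.inj ((hs.readied _ h).symm.trans h')
  · exact Option.some.inj (h.symm.trans (hs.readied _ h'))

theorem InEpoch.cfg_eq_cfg (hbyz : byz.card ≤ P.f) {e i i' : ℕ} {u u' : P.Rep}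
    (h : E.InEpoch e i u) (h' : E.InEpoch e i' u') :
    (E.state i u).cfg = (E.state i' u').cfg := by
  obtain ⟨ha, he⟩ := h
  obtain ⟨ha', he'⟩ := h'
  rcases (E.inv i u).entered ha with ⟨h1, hc⟩ | ⟨h2, V, -, -, hd, -⟩ <;>
    rcases (E.inv i' u').entered ha' with ⟨h1', hc'⟩ | ⟨h2', V', -, -, hd', -⟩
  · rw [hc, hc']
  · omega
  · omega
  · unfold RState.Delivered at hd hd'
    rw [he] at hd
    rw [he'] at hd'
    obtain ⟨w, hw, hg, hg'⟩ := hd.exists_correct_and hbyz hd'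
    obtain ⟨j, -, hs⟩ := E.sends_of_got hw hg
    obtain ⟨j', -, hs'⟩ := E.sends_of_got hw hg'
    exact readied_unique (hs.ready_inv.1.symm.trans hs'.ready_inv.1) hs.ready_inv.2 hs'.ready_inv.2

theorem InEpoch.cfg_eq_config (hbyz : byz.card ≤ P.f) {e i : ℕ} {u : P.Rep} (hu : u ∉ byz)
    (h : E.InEpoch e i u) : (E.state i u).cfg = E.config e := by
  have hex : ∃ x : ℕ × P.Rep, x.2 ∉ byz ∧ E.InEpoch e x.1 x.2 := ⟨(i, u), hu, h⟩
  rw [config, dif_pos hex]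
  exact h.cfg_eq_cfg hbyz hex.choose_spec.2

/-! ### Origin of certificates and proposals -/

theorem exists_got_preparedCert {i : ℕ} {u : P.Rep} {d : Entry Client Op}
    (h : d ∈ (E.state i u).prepared) : ∃ j ≤ i, E.InEpoch d.epoch j u ∧
      ∃ v, (E.state j u).Got v (.preparedCert d) ∧ d.sn ∈ (E.state j u).cfg.own v := by
  obtain ⟨j, hj, hn, hp, ⟨src, m, -, hs⟩ | hact⟩ :=
    E.exists_step_of_change (p := (d ∈ ·.prepared)) (Finset.notMem_empty _) h
  · rw [hs, RState.receive_prepared] at hp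
    exact absurd hp hn
  · obtain ⟨ha, he, v, hg, hv⟩ := (hact.mem_prepared hp).resolve_left hn
    exact ⟨j, hj.le, ⟨ha, he.symm⟩, v, hg, hv⟩

theorem accepted_of_supported (hbyz : byz.card ≤ P.f) {i e sn : ℕ} {v : P.Rep}
    {x : Option (Request Client Op)} (hv : v ∉ byz) (hsn : sn ∈ (E.config e).own v)
    (h : E.Supported i (.commit ⟨e, sn, x⟩)) :
    ∃ j ≤ i, E.InEpoch e j v ∧ (E.state j v).accepted sn = some x := by
  obtain ⟨y, hy, j, hj, z, hs⟩ := h.exists_sends hbyz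
  obtain ⟨k, hk, hin, w, hg, hw⟩ := exists_got_preparedCert hs.commit_inv.2.2
  rw [hin.cfg_eq_config hbyz hy] at hw
  obtain rfl := (E.config_sound e).own_unique hw hsn
  obtain ⟨l, hl, hs'⟩ := E.sends_of_got hv hg
  obtain ⟨ha, he, hacc⟩ := hs'.preparedCert_inv
  exact ⟨l, (hl.le.trans hk).trans hj, ⟨ha, he.symm⟩, hacc⟩

theorem exists_proposes {i : ℕ} {u : P.Rep} {sn : ℕ} {r : Request Client Op}
    (h : (E.state i u).proposed sn = some r) :
    ∃ j < i, (E.state j u).epoch = (E.state i u).epoch ∧ (E.state j u).Proposes u sn r := by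
  obtain ⟨j, hj, hn, ⟨he, hp⟩, ⟨src, m, -, hs⟩ | hact⟩ :=
    E.exists_step_of_change (p := fun s => s.epoch = (E.state i u).epoch ∧ s.proposed sn = some r)
      (fun h => Option.some_ne_none r h.2.symm) ⟨rfl, h⟩
  · rw [hs, RState.receive_epoch] at he
    rw [hs, RState.receive_proposed] at hp
    exact absurd ⟨he, hp⟩ hn
  · obtain ⟨heq, hp⟩ := hact.proposed hp
    rw [heq] at he
    exact ⟨j, hj, he, hp.resolve_left fun hp => hn ⟨he, hp⟩⟩

/-! ### Calls for epoch-changes -/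

theorem sender_epoch_of_sends {i : ℕ} {u w : P.Rep} {c : EpochChange P Op}
    (h : (E.state i u).Sends u w (.epochChange c)) :
    c.sender = u ∧ c.epoch = (E.state i u).epoch :=
  ((E.inv i u).of_call c h.epochChange_inv).imp_right And.left

theorem le_epoch_of_calledBy {i e : ℕ} {u w : P.Rep} (hw : w ∉ byz)
    (h : (E.state i u).CalledBy w e) : e ≤ (E.state i w).epoch := by
  obtain ⟨c, hg, -, rfl⟩ := h
  obtain ⟨j, hj, hs⟩ := E.sends_of_got hw hg
  rw [(sender_epoch_of_sends hs).2]
  exact E.epoch_mono hj.le w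

variable (E) in
/-- At step `i`, `f + 1` correct replicas have called for epoch `e` or a higher one. -/
def Reached (e i : ℕ) : Prop :=
  AtLeast P (P.f + 1) (fun w => w ∉ byz ∧ e ≤ (E.state i w).epoch)

theorem reached_of_calledBy (hbyz : byz.card ≤ P.f) {i e : ℕ} {u : P.Rep}
    (h : AtLeast P (2 * P.f + 1) (fun w => ∃ e', e ≤ e' ∧ (E.state i u).CalledBy w e')) :
    E.Reached e i :=
  (h.and_correct hbyz).mono le_rfl fun _ ⟨hw, _, he, hc⟩ =>
    ⟨hw, he.trans (le_epoch_of_calledBy hw hc)⟩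

theorem exists_sends_of_got_newEpoch {i e : ℕ} {u w : P.Rep} {V : Finset (EpochChange P Op)}
    (h : (E.state i u).Got w (.newEpoch e V)) {c : EpochChange P Op} (hc : c ∈ V)
    (hsender : c.sender ∉ byz) :
    ∃ j ≤ i, ∃ z, (E.state j c.sender).Sends c.sender z (.epochChange c) := by
  by_cases hw : w ∈ byz
  · obtain ⟨k, hk, he⟩ := E.deliver_of_mem_inbox h
    obtain ⟨j, hj, hs⟩ := (E.unforgeable k w u _ he hw).1 _ ⟨c, hc, rfl⟩ hsender
    exact ⟨j, hj.trans hk.le, hs⟩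
  · obtain ⟨k, hk, hs⟩ := E.sends_of_got hw h
    obtain ⟨j, hj, hs⟩ :=
      E.sends_of_got hsender (((E.inv k w).selected V hs.newEpoch_inv.2).2 c hc)
    exact ⟨j, (hj.trans hk).le, w, hs⟩

theorem reached_of_newEpoch (hbyz : byz.card ≤ P.f) {i e : ℕ} {u w : P.Rep}
    {V : Finset (EpochChange P Op)} (h : (E.state i u).Got w (.newEpoch e V))
    (hV : ValidV P e V) : E.Reached e i := by
  obtain ⟨hcard, hep, hinj⟩ := hV
  suffices AtLeast P (2 * P.f + 1) (fun w => w ∉ byz → e ≤ (E.state i w).epoch) from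
    (this.and_correct hbyz).mono le_rfl fun w hw => ⟨hw.1, hw.2 hw.1⟩
  refine ⟨V.image EpochChange.sender, ?_, fun w hw => ?_⟩
  · rw [Finset.card_image_of_injOn (fun c hc c' hc' => hinj c hc c' hc'), hcard]
  · obtain ⟨c, hc, rfl⟩ := Finset.mem_image.1 hw
    intro hb
    obtain ⟨j, hj, z, hs⟩ := exists_sends_of_got_newEpoch h hc hb
    rw [← hep c hc, (sender_epoch_of_sends hs).2]
    exact E.epoch_mono hj _

/-! ### Real time -/

variable (E)

theorem time_nonneg (i : ℕ) : 0 ≤ E.time i := E.time_zero ▸ E.time_mono (Nat.zero_le i)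

theorem exists_lt_time_succ (t : ℝ) : ∃ i, t < E.time (i + 1) := by
  obtain ⟨i, hi⟩ := (E.time_unbounded.eventually_gt_atTop t).exists
  exact ⟨i, hi.trans_le (E.time_mono (Nat.le_succ i))⟩

/-- The index of the state at real time `t`, after all events up to that time. -/
def indexAt (t : ℝ) : ℕ := Nat.find (E.exists_lt_time_succ t)

theorem lt_time_indexAt_succ (t : ℝ) : t < E.time (E.indexAt t + 1) :=
  Nat.find_spec (E.exists_lt_time_succ t)

variable {E}

theorem time_indexAt_le {t : ℝ} (ht : 0 ≤ t) : E.time (E.indexAt t) ≤ t := by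
  rcases h : E.indexAt t with _ | i
  · rwa [E.time_zero]
  · exact not_lt.1 (Nat.find_min (E.exists_lt_time_succ t) (show i < E.indexAt t by omega))

theorem le_indexAt {t : ℝ} {i : ℕ} (h : E.time i ≤ t) : i ≤ E.indexAt t :=
  not_lt.1 fun hlt => ((E.time_mono (Nat.succ_le_of_lt hlt)).trans h).not_gt
    (E.lt_time_indexAt_succ t)

theorem indexAt_mono {t t' : ℝ} (ht : 0 ≤ t) (h : t ≤ t') : E.indexAt t ≤ E.indexAt t' :=
  le_indexAt ((time_indexAt_le ht).trans h)

theorem not_act_indexAt {t : ℝ} (ht : 0 ≤ t) {u : P.Rep} (hu : u ∉ byz) (s : RState P Op) :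
    ¬ RState.Act u t (E.state (E.indexAt t) u) s :=
  E.urgent _ t (time_indexAt_le ht) (E.lt_time_indexAt_succ t) u hu s

theorem got_indexAt_add_of_sends {t : ℝ} (ht : 0 ≤ t) (hG : E.GST ≤ t) {u w : P.Rep} (hu : u ∉ byz)
    (hw : w ∉ byz) {m : Msg P Op} (h : (E.state (E.indexAt t) u).Sends u w m) :
    (E.state (E.indexAt (t + P.Δ)) w).Got u m := by
  obtain ⟨i, he, hi⟩ := E.network _ u w m hu hw h
  have hsent : max (E.time (E.indexAt t)) E.GST ≤ t := max_le (time_indexAt_le ht) hG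
  exact E.mem_inbox_of_deliver (Nat.lt_of_succ_le (le_indexAt (by linarith))) he

theorem eventually_got_of_sends {i : ℕ} {u w : P.Rep} (hu : u ∉ byz) (hw : w ∉ byz) {m : Msg P Op}
    (h : (E.state i u).Sends u w m) : ∀ᶠ j in Filter.atTop, (E.state j w).Got u m := by
  obtain ⟨j, he, -⟩ := E.network _ u w m hu hw h
  filter_upwards [Filter.eventually_gt_atTop j] with k hk
  exact E.mem_inbox_of_deliver hk he

theorem exists_sends_epochChange {i : ℕ} {u : P.Rep} (h : 2 ≤ (E.state i u).epoch) :
    ∃ c, c.sender = u ∧ c.epoch = (E.state i u).epoch ∧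
      ∀ w, (E.state i u).Sends u w (.epochChange c) := by
  obtain ⟨c, hc⟩ := Option.ne_none_iff_exists'.1 ((E.inv i u).call_ne_none h)
  obtain ⟨hsender, hepoch, -⟩ := (E.inv i u).of_call c hc
  exact ⟨c, hsender, hepoch, fun w => .epochChange w c hc⟩

/-! ### Progress of the epochs -/

theorem eventually_forall_correct {p : P.Rep → ℕ → Prop}
    (h : ∀ w ∉ byz, ∀ᶠ i in Filter.atTop, p w i) : ∀ᶠ i in Filter.atTop, ∀ w ∉ byz, p w i := by
  simpa only [Filter.eventually_all, Filter.eventually_imp_distrib_left] using h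

/-- From step `N` on, replica `u` remains in epoch `e`. -/
def StuckIn (E : Execution P Op byz good) (u : P.Rep) (e N : ℕ) : Prop :=
  ∀ i ≥ N, (E.state i u).epoch = e

theorem StuckIn.sameEpoch {u : P.Rep} {e N i j : ℕ} (h : E.StuckIn u e N) (hi : N ≤ i)
    (hij : i ≤ j) : (E.state i u).SameEpoch (E.state j u) :=
  (E.evolves hij u).same ((h j (hi.trans hij)).trans (h i hi).symm)

theorem StuckIn.not_active {u : P.Rep} {e N i : ℕ} (h : E.StuckIn u e N) (hu : u ∉ byz)
    (hi : N ≤ i) : ¬ (E.state i u).active := by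
  intro ha
  set t := max (E.time i) (E.state i u).epochTimer with ht
  have h0 : 0 ≤ t := (E.time_nonneg i).trans (le_max_left _ _)
  have hsame := h.sameEpoch hi (le_indexAt (ht ▸ le_max_left _ _))
  refine not_act_indexAt h0 hu _ (.callExpired (hsame.active ha) ?_)
  rw [hsame.epochTimer ha]
  exact le_max_right _ _

theorem StuckIn.changeTimer_eq_none {u : P.Rep} {e N i : ℕ} (h : E.StuckIn u e N) (hu : u ∉ byz)
    (hi : N ≤ i) : (E.state i u).changeTimer = none := by
  by_contra hne
  obtain ⟨τ, hτ⟩ := Option.ne_none_iff_exists'.1 hne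
  have h0 : 0 ≤ max (E.time i) τ := (E.time_nonneg i).trans (le_max_left _ _)
  have hle : i ≤ E.indexAt (max (E.time i) τ) := le_indexAt (le_max_left _ _)
  have hinact := h.not_active hu (hi.trans hle)
  exact not_act_indexAt h0 hu _ (.callNext τ hinact
    (((h.sameEpoch hi hle).changeTimer τ hτ).resolve_left hinact) (le_max_right _ _))

theorem eventually_calledBy {e i : ℕ} {u w : P.Rep} (hu : u ∉ byz) (hw : w ∉ byz) (he : 2 ≤ e)
    (h : e ≤ (E.state i w).epoch) :
    ∀ᶠ j in Filter.atTop, ∃ e', e ≤ e' ∧ (E.state j u).CalledBy w e' := by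
  obtain ⟨c, hsender, hepoch, hs⟩ := exists_sends_epochChange (he.trans h)
  filter_upwards [eventually_got_of_sends hw hu (hs u)] with j hj
  exact ⟨_, h, c, hj, hsender, hepoch⟩

/-- An active replica leaves its epoch when the epoch timer expires, an inactive one when the
epoch-change timer does, and the calls of all correct replicas start the latter. -/
theorem not_stuckIn (hbyz : byz.card ≤ P.f) {e N : ℕ} (hN : ∀ w ∉ byz, e ≤ (E.state N w).epoch)
    {u : P.Rep} (hu : u ∉ byz) : ¬ E.StuckIn u e N := by
  intro h
  have he : 2 ≤ e := h N le_rfl ▸ (E.inv N u).two_le_epoch (h.not_active hu le_rfl)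
  have hcalls := eventually_forall_correct fun w hw => eventually_calledBy hu hw he (hN w hw)
  obtain ⟨M, hM⟩ := Filter.eventually_atTop.1 (hcalls.and (Filter.eventually_ge_atTop N))
  obtain ⟨hall, hle⟩ := hM (E.indexAt (E.time M)) (le_indexAt le_rfl)
  refine not_act_indexAt (E.time_nonneg M) hu _
    (.startTimer (h.not_active hu hle) (h.changeTimer_eq_none hu hle) ?_)
  rw [h _ hle]
  exact atLeast_of_correct hbyz le_rfl hall

theorem eventually_le_epoch (hbyz : byz.card ≤ P.f) (e : ℕ) :
    ∀ᶠ i in Filter.atTop, ∀ w ∉ byz, e ≤ (E.state i w).epoch := by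
  induction e with
  | zero => exact .of_forall fun _ _ _ => Nat.zero_le _
  | succ e ih =>
    obtain ⟨N, hN⟩ := ih.exists
    refine eventually_forall_correct fun w hw => ?_
    obtain ⟨i, hi, hne⟩ : ∃ i ≥ N, (E.state i w).epoch ≠ e := by
      simpa [StuckIn] using not_stuckIn hbyz hN hw
    filter_upwards [Filter.eventually_ge_atTop i] with j hj
    exact (((hN w hw).trans (E.epoch_mono hi w)).lt_of_ne' hne).trans_le (E.epoch_mono hj w)

end Execution

namespace RState

variable {s s' : RState P Op} {u : P.Rep} {t : ℝ}

theorem Act.cases_leave {e : ℕ} (h : Act u t s s') (hle : s.epoch ≤ e) (hlt : e < s'.epoch) :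
    AtLeast P (P.f + 1) (fun w => ∃ e', e < e' ∧ s.CalledBy w e') ∨
      s.epoch = e ∧ ((s.active ∧ ∀ v, s.Finished v) ∨ (s.active ∧ s.epochTimer ≤ t) ∨
        (s.active ∧ ∃ v, s.progressTimer v ≤ t) ∨ ∃ τ, s.changeTimer = some τ ∧ τ ≤ t) := by
  have epoch_eq : e < s.epoch + 1 → s.epoch = e := by omega
  cases h with
  | callFinished ha hf => exact .inr ⟨epoch_eq hlt, .inl ⟨ha, hf⟩⟩
  | callExpired ha hexp => exact .inr ⟨epoch_eq hlt, .inr (.inl ⟨ha, hexp⟩)⟩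
  | callNoProgress ha hexp =>
    obtain ⟨W, hW, hexp⟩ := hexp
    obtain ⟨v, hv⟩ := Finset.card_pos.1 (show 0 < W.card by omega)
    exact .inr ⟨epoch_eq hlt, .inr (.inr (.inl ⟨ha, v, hexp v hv⟩))⟩
  | callNext τ _ hτ hexp => exact .inr ⟨epoch_eq hlt, .inr (.inr (.inr ⟨τ, hτ, hexp⟩))⟩
  | callFollow e' hW hleast =>
    refine .inl (hW.mono le_rfl ?_)
    rintro w ⟨hw, e'', he'', hc⟩
    exact ⟨e'', hlt.trans_le (hleast.2 ⟨he'', w, hw, hc⟩), hc⟩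
  | _ => exact absurd hlt hle.not_gt

/-- No timer that runs in `s` was started before time `τ`. -/
structure TimersAfter (s : RState P Op) (τ : ℝ) : Prop where
  changeTimer : ∀ x, s.changeTimer = some x → τ + P.Te ≤ x
  epochTimer : s.active → τ + P.T ≤ s.epochTimer
  progressTimer : s.active → ∀ v, τ + 5 * P.Δ + P.Tp ≤ s.progressTimer v

theorem TimersAfter.receive {τ : ℝ} (h : s.TimersAfter τ) (src : Option P.Rep) (m : Msg P Op) :
    (s.receive t src m).TimersAfter τ := by
  constructor <;> simp only [receive_changeTimer, receive_active, receive_epochTimer]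
  · exact h.changeTimer
  · exact h.epochTimer
  · exact fun ha v => (h.progressTimer ha v).trans (le_receive_progressTimer ..)

theorem Te_le_changeTimeout (hTe : 0 ≤ P.Te) (fails : ℕ) : P.Te ≤ changeTimeout P fails := by
  unfold changeTimeout
  split_ifs
  · exact le_mul_of_one_le_right hTe (one_le_pow₀ one_le_two)
  · exact le_rfl

theorem TimersAfter.act {τ : ℝ} (h : s'.epoch = s.epoch → s.TimersAfter τ) (hTe : 0 ≤ P.Te)
    (hcall : AtLeast P (2 * P.f + 1) (fun w => ∃ e', s'.epoch ≤ e' ∧ s.CalledBy w e') → τ ≤ t)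
    (hnew : ∀ w V, s.Got w (.newEpoch s'.epoch V) → ValidV P s'.epoch V → τ ≤ t)
    (ha : Act u t s s') : s'.TimersAfter τ := by
  cases ha with
  | callFinished | callExpired | callNoProgress | callNext | callFollow =>
    exact ⟨fun _ hx => (Option.some_ne_none _ hx.symm).elim, False.elim, False.elim⟩
  | startTimer hn _ hq =>
    refine ⟨fun x hx => ?_, fun ha => absurd ha hn, fun ha => absurd ha hn⟩
    cases hx
    exact add_le_add (hcall hq) (Te_le_changeTimeout hTe _)
  | enter V _ hg hV _ =>
    have := hnew _ V hg hV
    refine ⟨fun _ hx => (Option.some_ne_none _ hx.symm).elim, fun _ => ?_, fun _ _ => ?_⟩ <;>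
      (simp only [enter]; linarith)
  | _ => exact { h rfl with }

end RState

/-- The timers run for at least `d`. -/
structure Protocol.TimersLast (P : Protocol Client) (d : ℝ) : Prop where
  Te : d ≤ P.Te
  T : d ≤ P.T
  Tp : d ≤ P.Tp

namespace Execution

variable {byz : Finset P.Rep} {good : Set Client} {E : Execution P Op byz good}

theorem timersAfter (hbyz : byz.card ≤ P.f) {e J i : ℕ} {u : P.Rep} (he : 2 ≤ e)
    (hJ : ∀ i, E.Reached e i → J ≤ i) (hTe : 0 ≤ P.Te) (hi : (E.state i u).epoch = e) :
    (E.state i u).TimersAfter (E.time J) := by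
  induction i with
  | zero =>
    rw [E.start] at hi
    exact absurd (he.trans_eq hi.symm : 2 ≤ 1) (by decide)
  | succ i ih =>
    have time_le : E.Reached e i → E.time J ≤ E.time (i + 1) := fun h =>
      E.time_mono ((hJ i h).trans i.le_succ)
    rcases E.step i u with h | ⟨src, m, -, h⟩ | h
    · exact h ▸ ih (h ▸ hi)
    · rw [h, RState.receive_epoch] at hi
      exact h ▸ (ih hi).receive src m
    · subst hi
      exact .act (fun heq => ih heq.symm) hTe (fun hq => time_le (reached_of_calledBy hbyz hq))
        (fun w V hg hV => time_le (reached_of_newEpoch hbyz hg hV)) h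

/-- The first correct replica to leave `e` does not follow others, so if it leaves before its timers
can expire, it has finished `e`. -/
theorem exists_finished (hbyz : byz.card ≤ P.f) {e J : ℕ} (he : 2 ≤ e)
    (hJ : ∀ i, E.Reached e i → J ≤ i) (hΔ : 0 ≤ P.Δ) {d : ℝ}
    (hd : 0 ≤ d) (hP : P.TimersLast d) {n : ℕ}
    (hn : E.time n < E.time J + d) {u : P.Rep} (hu : u ∉ byz) (hgt : e < (E.state n u).epoch) :
    ∃ i, ∃ w ∉ byz, E.InEpoch e i w ∧ ∀ v, (E.state i w).Finished v := by
  obtain ⟨i, hi, hnot, w, hw, hgt'⟩ := exists_lt_not_and_succ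
    (p := fun i => ∃ w ∉ byz, e < (E.state i w).epoch) (by
      rintro ⟨w, -, hlt⟩
      rw [E.start] at hlt
      exact absurd (he.trans_lt hlt) (by decide : ¬ 2 < 1)) ⟨u, hu, hgt⟩
  have hle : ∀ x ∉ byz, (E.state i x).epoch ≤ e := fun x hx => not_lt.1 fun h => hnot ⟨x, hx, h⟩
  have htime : E.time (i + 1) < E.time J + d := (E.time_mono hi).trans_lt hn
  rcases E.step i w with h | ⟨src, m, -, h⟩ | h
  · exact absurd hgt' (h ▸ hle w hw).not_gt
  · rw [h, RState.receive_epoch] at hgt'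
    exact absurd hgt' (hle w hw).not_gt
  · rcases h.cases_leave (hle w hw) hgt' with h | ⟨hep, h⟩
    · obtain ⟨x, hx, e', he', hc⟩ := h.exists_correct hbyz le_rfl
      exact absurd (le_epoch_of_calledBy hx hc) (not_le.2 ((hle x hx).trans_lt he'))
    · have htimers := timersAfter hbyz he hJ (hd.trans hP.Te) hep
      rcases h with ⟨ha, h⟩ | ⟨ha, h⟩ | ⟨ha, v, h⟩ | ⟨τ, h, h'⟩
      · exact ⟨i, w, hw, ⟨ha, hep⟩, h⟩
      · linarith [htimers.epochTimer ha, hP.T]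
      · linarith [htimers.progressTimer ha v, hP.Tp]
      · linarith [htimers.changeTimer τ h, hP.Te]

/-! ### Synchronous rounds -/

variable (E) in
/-- The steps `J 0, J 1, …` delimit synchronous rounds: a message that a correct replica sends at
one of them has arrived at the next, and the correct replicas have performed all possible local
actions. -/
structure Synchronous (J : ℕ → ℕ) : Prop where
  mono : Monotone J
  got : ∀ n {u w m}, u ∉ byz → w ∉ byz → (E.state (J n) u).Sends u w m →
    (E.state (J (n + 1)) w).Got u m
  quiet : ∀ n {u}, u ∉ byz → ∃ t, ∀ s, ¬ RState.Act u t (E.state (J n) u) s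

theorem synchronous_indexAt {t : ℝ} (ht : 0 ≤ t) (hG : E.GST ≤ t) (hΔ : 0 ≤ P.Δ) :
    E.Synchronous fun n => E.indexAt (t + n * P.Δ) where
  mono n m hnm := indexAt_mono (by positivity) (by gcongr)
  got n u w m hu hw hs := by
    have hle : t ≤ t + n * P.Δ := le_add_of_nonneg_right (by positivity)
    have := got_indexAt_add_of_sends (by positivity) (hG.trans hle) hu hw hs
    rwa [add_assoc, ← add_one_mul, ← Nat.cast_succ] at this
  quiet n u hu := ⟨_, not_act_indexAt (by positivity) hu⟩

/-! ### The reliable broadcast of a correct primary -/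

theorem selected_unique {i j : ℕ} {u : P.Rep} {V V' : Finset (EpochChange P Op)}
    (he : (E.state i u).epoch = (E.state j u).epoch) (h : (E.state i u).selected = some V)
    (h' : (E.state j u).selected = some V') : V = V' := by
  rcases E.sameEpoch_total he with hs | hs
  · exact Option.some.inj ((hs.selected _ h).symm.trans h')
  · exact Option.some.inj (h.symm.trans (hs.selected _ h'))

variable (E) in
/-- At step `k`, the correct primary of epoch `e` has selected the epoch-change messages `V`. -/
structure PrimarySelected (e k : ℕ) (V : Finset (EpochChange P Op)) : Prop where
  primary : P.primary e ∉ byz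
  epoch_eq : (E.state k (P.primary e)).epoch = e
  selected : (E.state k (P.primary e)).selected = some V

theorem PrimarySelected.echoed_eq {e i k : ℕ} {V : Finset (EpochChange P Op)}
    (hV : E.PrimarySelected e k V) {u : P.Rep} {cfg : Config P Op}
    (he : (E.state i u).epoch = e) (h : (E.state i u).echoed = some cfg) :
    cfg = newConfig P e V := by
  have hg := (E.inv i u).echoed cfg h
  rw [he] at hg
  obtain ⟨j, -, hs⟩ := E.sends_of_got hV.primary hg
  obtain ⟨hej, V', hV', rfl⟩ := hs.init_inv
  rw [selected_unique (hV.epoch_eq.trans hej) hV.selected hV', ← hej]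

theorem PrimarySelected.readied_eq (hbyz : byz.card ≤ P.f) {e i k : ℕ}
    {V : Finset (EpochChange P Op)} (hV : E.PrimarySelected e k V) {u : P.Rep} {cfg : Config P Op}
    (he : (E.state i u).epoch = e) (h : (E.state i u).readied = some cfg) :
    cfg = newConfig P e V := by
  induction i using Nat.strong_induction_on generalizing u with
  | _ i ih =>
    have hquorum := (E.inv i u).readied cfg h
    unfold RState.ReadyQuorum at hquorum
    rw [he] at hquorum
    rcases hquorum with hquorum | hquorum
    · obtain ⟨w, hw, hg⟩ := hquorum.exists_correct hbyz (by omega)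
      obtain ⟨j, -, hs⟩ := E.sends_of_got hw hg
      exact hV.echoed_eq hs.echo_inv.1.symm hs.echo_inv.2
    · obtain ⟨w, hw, hg⟩ := hquorum.exists_correct hbyz le_rfl
      obtain ⟨j, hj, hs⟩ := E.sends_of_got hw hg
      exact ih j hj hs.ready_inv.1.symm hs.ready_inv.2

theorem InEpoch.exists_selected {e i : ℕ} (h : E.InEpoch e i (P.primary e)) (he : 2 ≤ e)
    (hp : P.primary e ∉ byz) : ∃ V, (E.state i (P.primary e)).selected = some V := by
  rcases (E.inv _ _).entered h.active with ⟨h1, -⟩ | ⟨-, V, hg, -⟩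
  · exact absurd (he.trans_eq (h.epoch_eq.symm.trans h1)) (by decide)
  · rw [h.epoch_eq] at hg
    obtain ⟨j, hj, hs⟩ := E.sends_of_got hp hg
    obtain ⟨hej, hV⟩ := hs.newEpoch_inv
    exact ⟨V, ((E.evolves hj.le _).same (h.epoch_eq.trans hej)).selected V hV⟩

end Execution

theorem exists_validV {byz : Finset P.Rep} (hbyz : byz.card ≤ P.f) {e : ℕ} {u : P.Rep}
    (hu : u ∉ byz) {S : EpochChange P Op → Prop}
    (h : ∀ w ∉ byz, ∃ c, S c ∧ c.sender = w ∧ c.epoch = e) :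
    ∃ V, ValidV P e V ∧ (∀ c ∈ V, S c) ∧ ∃ c ∈ V, c.sender = u := by
  obtain ⟨W, huW, hW, hcard⟩ := Finset.exists_subsuperset_card_eq
    (Finset.singleton_subset_iff.2 (Finset.mem_compl.2 hu)) (by simp) (le_card_compl hbyz)
  have : Nonempty (EpochChange P Op) := (h u hu).nonempty
  choose! c hS hsender hepoch using fun w (hw : w ∈ W) => h w (Finset.mem_compl.1 (hW hw))
  refine ⟨W.image c, ⟨?_, ?_, ?_⟩, Finset.forall_mem_image.2 hS,
    c u, Finset.mem_image_of_mem c (huW (Finset.mem_singleton_self u)),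
    hsender u (huW (Finset.mem_singleton_self u))⟩
  · rw [Finset.card_image_of_injOn, hcard]
    exact fun w hw w' hw' heq => by rw [← hsender w hw, heq, hsender w' hw']
  · exact Finset.forall_mem_image.2 hepoch
  · rw [Finset.forall_mem_image]
    intro w hw
    rw [Finset.forall_mem_image]
    intro w' hw' heq
    rw [hsender w hw, hsender w' hw'] at heq
    rw [heq]

namespace Execution

variable {byz : Finset P.Rep} {good : Set Client} {E : Execution P Op byz good}

/-! ### An epoch with a correct primary after stabilization -/

variable (E) in
/-- The synchronous rounds `J` start when epoch `e` is reached, its primary is correct, and no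
correct replica leaves it for `17` rounds. These suffice to synchronize the replicas and to
broadcast the configuration (`6`), to commit the hanging sequence numbers (`4`), to exchange
checkpoints (`2`), and to propose and commit the first fresh sequence number (`5`). -/
structure StableEpoch (e : ℕ) (J : ℕ → ℕ) : Prop extends E.Synchronous J where
  two_le : 2 ≤ e
  reached : E.Reached e (J 0)
  stay : ∀ u ∉ byz, (E.state (J 17) u).epoch ≤ e
  primary : P.primary e ∉ byz

namespace StableEpoch

variable {e : ℕ} {J : ℕ → ℕ}

theorem epoch_le (h : E.StableEpoch e J) (n : ℕ) {u : P.Rep} (hu : u ∉ byz)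
    (hn : n ≤ 17 := by omega) : (E.state (J n) u).epoch ≤ e :=
  (E.epoch_mono (h.mono hn) u).trans (h.stay u hu)

theorem calledBy_one (h : E.StableEpoch e J) {u w : P.Rep} (hu : u ∉ byz) (hw : w ∉ byz)
    (hle : e ≤ (E.state (J 0) w).epoch) : (E.state (J 1) u).CalledBy w e := by
  have heq : (E.state (J 0) w).epoch = e := (h.epoch_le 0 hw).antisymm hle
  obtain ⟨c, hsender, hepoch, hs⟩ := exists_sends_epochChange (heq.symm ▸ h.two_le)
  exact ⟨c, h.got 0 hw hu (hs u), hsender, hepoch.trans heq⟩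

theorem le_epoch_one (h : E.StableEpoch e J) {u : P.Rep} (hu : u ∉ byz) :
    e ≤ (E.state (J 1) u).epoch := by
  by_contra! hlt
  obtain ⟨W, hW, hWe⟩ := h.reached
  have hcall : ∀ w ∈ W, w ≠ u ∧ (E.state (J 1) u).CalledBy w e := by
    refine fun w hw => ⟨?_, h.calledBy_one hu (hWe w hw).1 (hWe w hw).2⟩
    rintro rfl
    exact hlt.not_ge ((hWe w hw).2.trans (E.epoch_mono (h.mono zero_le_one) w))
  obtain ⟨t, ht⟩ := h.quiet 1 hu
  set A := {e' | (E.state (J 1) u).epoch < e' ∧ ∃ w, w ≠ u ∧ (E.state (J 1) u).CalledBy w e'}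
  have hA : A.Nonempty := by
    obtain ⟨w, hw⟩ := Finset.card_pos.1 (show 0 < W.card by omega)
    exact ⟨e, hlt, w, hcall w hw⟩
  exact ht _ (.callFollow (sInf A)
    ⟨W, hW, fun w hw => ⟨(hcall w hw).1, e, hlt, (hcall w hw).2⟩⟩
    ⟨Nat.sInf_mem hA, fun _ hx => Nat.sInf_le hx⟩)

theorem epoch_eq (h : E.StableEpoch e J) (n : ℕ) {u : P.Rep} (hu : u ∉ byz)
    (h1 : 1 ≤ n := by omega) (hn : n ≤ 17 := by omega) : (E.state (J n) u).epoch = e :=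
  (h.epoch_le n hu).antisymm ((h.le_epoch_one hu).trans (E.epoch_mono (h.mono h1) u))

theorem sameEpoch (h : E.StableEpoch e J) (n m : ℕ) {u : P.Rep} (hu : u ∉ byz)
    (h1 : 1 ≤ n := by omega) (hnm : n ≤ m := by omega) (hm : m ≤ 17 := by omega) :
    (E.state (J n) u).SameEpoch (E.state (J m) u) :=
  (E.evolves (h.mono hnm) u).same ((h.epoch_eq m hu).trans (h.epoch_eq n hu).symm)

theorem exists_primarySelected (h : E.StableEpoch e J) (hbyz : byz.card ≤ P.f) :
    ∃ V, E.PrimarySelected e (J 2) V := by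
  have hepoch := h.epoch_eq 2 h.primary
  suffices ∃ V, (E.state (J 2) (P.primary e)).selected = some V from
    this.imp fun V hV => ⟨h.primary, hepoch, hV⟩
  by_cases ha : (E.state (J 2) (P.primary e)).active
  · exact InEpoch.exists_selected ⟨ha, hepoch⟩ h.two_le h.primary
  by_contra hnone
  have hgot : ∀ w ∉ byz, ∃ c, (E.state (J 2) (P.primary e)).Got c.sender (.epochChange c) ∧
      c.sender = w ∧ c.epoch = e := by
    intro w hw
    obtain ⟨c, rfl, hc, hs⟩ := exists_sends_epochChange ((h.epoch_eq 1 hw).symm ▸ h.two_le)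
    exact ⟨c, h.got 1 hw h.primary (hs _), rfl, hc.trans (h.epoch_eq 1 hw)⟩
  obtain ⟨V, hV, hVgot, hown⟩ := exists_validV hbyz h.primary hgot
  obtain ⟨t, ht⟩ := h.quiet 2 h.primary
  exact ht _ (.select V ha (by rw [hepoch])
    (Option.eq_none_iff_forall_ne_some.2 fun V hV => hnone ⟨V, hV⟩) (by rwa [hepoch]) hVgot hown)

theorem echoed (h : E.StableEpoch e J) {V : Finset (EpochChange P Op)}
    (hV : E.PrimarySelected e (J 2) V) {u : P.Rep} (hu : u ∉ byz) :
    (E.state (J 3) u).echoed = some (newConfig P e V) := by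
  rcases hc : (E.state (J 3) u).echoed with _ | cfg
  · obtain ⟨t, ht⟩ := h.quiet 3 hu
    have hg := h.got 2 h.primary hu (.init u V hV.selected)
    rw [hV.epoch_eq] at hg
    exact absurd (.echo (newConfig P e V) hc (by rwa [h.epoch_eq 3 hu])) (ht _)
  · rw [hV.echoed_eq (h.epoch_eq 3 hu) hc]

theorem readied (h : E.StableEpoch e J) (hbyz : byz.card ≤ P.f) {V : Finset (EpochChange P Op)}
    (hV : E.PrimarySelected e (J 2) V) {u : P.Rep} (hu : u ∉ byz) :
    (E.state (J 4) u).readied = some (newConfig P e V) := by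
  rcases hc : (E.state (J 4) u).readied with _ | cfg
  · obtain ⟨t, ht⟩ := h.quiet 4 hu
    refine absurd (.ready (newConfig P e V) hc (Or.inl ?_)) (ht _)
    rw [h.epoch_eq 4 hu]
    refine atLeast_of_correct hbyz le_rfl fun w hw => ?_
    have hg := h.got 3 hw hu (.echo u _ (h.echoed hV hw))
    rwa [h.epoch_eq 3 hw] at hg
  · rw [hV.readied_eq hbyz (h.epoch_eq 4 hu) hc]

theorem delivered (h : E.StableEpoch e J) (hbyz : byz.card ≤ P.f) {V : Finset (EpochChange P Op)}
    (hV : E.PrimarySelected e (J 2) V) {u : P.Rep} (hu : u ∉ byz) :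
    (E.state (J 5) u).Delivered (newConfig P e V) := by
  unfold RState.Delivered
  rw [h.epoch_eq 5 hu]
  refine atLeast_of_correct hbyz le_rfl fun w hw => ?_
  have hg := h.got 4 hw hu (.ready u _ (h.readied hbyz hV hw))
  rwa [h.epoch_eq 4 hw] at hg

theorem active_six (h : E.StableEpoch e J) (hbyz : byz.card ≤ P.f) {u : P.Rep} (hu : u ∉ byz) :
    (E.state (J 6) u).active := by
  obtain ⟨V, hV⟩ := h.exists_primarySelected hbyz
  have hepoch := h.epoch_eq 5 h.primary
  have hV5 := (h.sameEpoch 2 5 h.primary).selected V hV.selected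
  have hvalid := ((E.inv _ _).selected V hV5).1
  rw [hepoch] at hvalid
  have hg := h.got 5 h.primary hu
    (.newEpoch u V hV5 (by rw [hepoch]; exact h.delivered hbyz hV h.primary))
  rw [hepoch] at hg
  have hdel := (h.delivered hbyz hV hu).mono (E.evolves (h.mono (Nat.le_succ 5)) u).inbox
    ((h.epoch_eq 6 hu).trans (h.epoch_eq 5 hu).symm)
  by_contra ha
  obtain ⟨t, ht⟩ := h.quiet 6 hu
  exact ht _ (.enter V ha (by rwa [h.epoch_eq 6 hu]) (by rwa [h.epoch_eq 6 hu])
    (by rwa [h.epoch_eq 6 hu]))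

theorem inEpoch (h : E.StableEpoch e J) (hbyz : byz.card ≤ P.f) (n : ℕ) {u : P.Rep} (hu : u ∉ byz)
    (h6 : 6 ≤ n := by omega) (hn : n ≤ 17 := by omega) : E.InEpoch e (J n) u :=
  ⟨(h.sameEpoch 6 n hu).active (h.active_six hbyz hu), h.epoch_eq n hu⟩

/-! ### Agreement on a sequence number of a correct leader -/

theorem cfg_eq (h : E.StableEpoch e J) (hbyz : byz.card ≤ P.f) (n : ℕ) {u : P.Rep} (hu : u ∉ byz)
    (h6 : 6 ≤ n := by omega) (hn : n ≤ 17 := by omega) : (E.state (J n) u).cfg = E.config e :=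
  (h.inEpoch hbyz n hu).cfg_eq_config hbyz hu

variable {v : P.Rep} {sn : ℕ} {x : Option (Request Client Op)}

theorem got_prepare (h : E.StableEpoch e J) (hbyz : byz.card ≤ P.f) (hv : v ∉ byz)
    (hsn : sn ∈ (E.config e).own v) (n : ℕ) {u : P.Rep} (hu : u ∉ byz)
    (hacc : (E.state (J n) u).accepted sn = some x)
    (h6 : 6 ≤ n := by omega) (hn : n ≤ 17 := by omega) :
    (E.state (J (n + 1)) v).Got u (.prepare ⟨e, sn, x⟩) := by
  have hs := RState.Sends.prepare (u := u) v sn x (h.inEpoch hbyz n hu).active hacc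
    (by rwa [h.cfg_eq hbyz n hu])
  rw [h.epoch_eq n hu] at hs
  exact h.got n hu hv hs

theorem mem_prepared (h : E.StableEpoch e J) (hbyz : byz.card ≤ P.f) (hv : v ∉ byz)
    (hsn : sn ∈ (E.config e).own v) (n : ℕ)
    (hacc : ∀ u ∉ byz, (E.state (J n) u).accepted sn = some x) {u : P.Rep} (hu : u ∉ byz)
    (h6 : 6 ≤ n := by omega) (hn : n + 2 ≤ 17 := by omega) :
    (⟨e, sn, x⟩ : Entry Client Op) ∈ (E.state (J (n + 2)) u).prepared := by
  have hacc' : (E.state (J (n + 1)) v).accepted sn = some x :=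
    (h.sameEpoch n (n + 1) hv).accepted (h.inEpoch hbyz n hv).active sn x (hacc v hv)
  have hg := h.got (n + 1) hv hu (.preparedCert u ⟨e, sn, x⟩ (h.inEpoch hbyz (n + 1) hv).active
    (h.epoch_eq (n + 1) hv).symm (by rwa [h.cfg_eq hbyz (n + 1) hv]) hacc'
    (atLeast_of_correct hbyz le_rfl fun w hw => h.got_prepare hbyz hv hsn n hw (hacc w hw)))
  by_contra hmem
  obtain ⟨t, ht⟩ := h.quiet (n + 2) hu
  exact ht _ (.acceptPrepared v ⟨e, sn, x⟩ (h.inEpoch hbyz (n + 2) hu).active hg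
    (h.epoch_eq (n + 2) hu).symm (by rwa [h.cfg_eq hbyz (n + 2) hu]) hmem)

theorem mem_certs_of_accepted (h : E.StableEpoch e J) (hbyz : byz.card ≤ P.f) (hv : v ∉ byz)
    (hsn : sn ∈ (E.config e).own v) (n : ℕ)
    (hacc : ∀ u ∉ byz, (E.state (J n) u).accepted sn = some x) {u : P.Rep} (hu : u ∉ byz)
    (h6 : 6 ≤ n := by omega) (hn : n + 4 ≤ 17 := by omega) :
    (⟨e, sn, x⟩ : Entry Client Op) ∈ (E.state (J (n + 4)) u).certs := by
  have hcommit : ∀ w ∉ byz, (E.state (J (n + 3)) v).Got w (.commit ⟨e, sn, x⟩) := fun w hw =>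
    h.got (n + 2) hw hv (.commit v ⟨e, sn, x⟩ (h.inEpoch hbyz (n + 2) hw).active
      (h.epoch_eq (n + 2) hw).symm (h.mem_prepared hbyz hv hsn n hacc hw)
      (by rwa [h.cfg_eq hbyz (n + 2) hw]))
  exact (E.inv _ u).commitCert _ _ (h.got (n + 3) hv hu
    (.commitCert u ⟨e, sn, x⟩ (h.inEpoch hbyz (n + 3) hv).active (h.epoch_eq (n + 3) hv).symm
      (by rwa [h.cfg_eq hbyz (n + 3) hv]) (atLeast_of_correct hbyz le_rfl hcommit)))

theorem mem_certs_of_hang (h : E.StableEpoch e J) (hbyz : byz.card ≤ P.f) (hv : v ∉ byz)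
    (hsn : sn ∈ (E.config e).own v) (hx : (E.config e).hang sn = some x) {u : P.Rep}
    (hu : u ∉ byz) : (⟨e, sn, x⟩ : Entry Client Op) ∈ (E.state (J 10) u).certs :=
  h.mem_certs_of_accepted hbyz hv hsn 6 (fun w hw => (E.inv _ w).accepted_of_hang
    (h.active_six hbyz hw) sn x (by rwa [h.cfg_eq hbyz 6 hw])) hu

/-! ### Watermarks -/

theorem le_low (h : E.StableEpoch e J) (hbyz : byz.card ≤ P.f) (hv : v ∉ byz) {l₁ l₂ : List ℕ}
    (hown : (E.config e).own v = l₁ ++ l₂) (hl₁ : ∀ sn ∈ l₁, (E.config e).hang sn ≠ none)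
    (hk : P.k ∣ l₁.length) (n : ℕ) {u : P.Rep} (hu : u ∉ byz) (h12 : 12 ≤ n := by omega)
    (hn : n ≤ 17 := by omega) : l₁.length ≤ (E.state (J n) u).low v := by
  rcases eq_or_ne l₁ [] with rfl | hnil
  · exact Nat.zero_le _
  choose! val hval using fun sn hsn => Option.ne_none_iff_exists'.1 (hl₁ sn hsn)
  set c : Ckpt P Op := ⟨e, v, l₁.map fun sn => (sn, val sn)⟩ with hc
  have hlen : c.log.length = l₁.length := List.length_map _
  have hck : ∀ w ∉ byz, (E.state (J 11) v).Got w (.checkpoint c) := by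
    intro w hw
    refine h.got 10 hw hv (.checkpoint c (h.inEpoch hbyz 10 hw).active (h.epoch_eq 10 hw).symm
      (by simpa [hc] using hnil) (hlen ▸ hk) ?_)
    rw [h.cfg_eq hbyz 10 hw, hlen, h.epoch_eq 10 hw]
    simp only [hc]
    rw [hown, List.take_left, List.forall₂_map_right_iff, List.forall₂_same]
    exact fun sn hsn => ⟨rfl, h.mem_certs_of_hang hbyz hv
      (hown ▸ List.mem_append_left l₂ hsn) (hval sn hsn) hw⟩
  have hg := h.got 11 hv hu (.checkpointCert u c (h.inEpoch hbyz 11 hv).active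
    (h.epoch_eq 11 hv).symm rfl (atLeast_of_correct hbyz le_rfl hck))
  have hstable := (E.evolves (h.mono h12) u).stable ((E.inv _ u).checkpointCert _ _ hg)
  rw [← hlen]
  exact Finset.le_sup (f := fun c : Ckpt P Op => c.log.length)
    (Finset.mem_filter.2 ⟨hstable, (h.epoch_eq n hu).symm, rfl⟩)

theorem lt_low_add (h : E.StableEpoch e J) (hbyz : byz.card ≤ P.f) (hk : 1 ≤ P.k) (hv : v ∉ byz)
    {l₁ l₂ : List ℕ} (hown : (E.config e).own v = l₁ ++ l₂)
    (hl₁ : ∀ sn ∈ l₁, (E.config e).hang sn ≠ none) (n : ℕ) {u : P.Rep} (hu : u ∉ byz)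
    (h12 : 12 ≤ n := by omega) (hn : n ≤ 17 := by omega) :
    l₁.length < (E.state (J n) u).low v + 2 * P.k := by
  have hdiv := Nat.div_add_mod l₁.length P.k
  have hmod := Nat.mod_lt l₁.length hk
  set L := P.k * (l₁.length / P.k)
  have hlen : (l₁.take L).length = L := List.length_take_of_le (by omega)
  have hle := h.le_low hbyz hv (l₁ := l₁.take L) (l₂ := l₁.drop L ++ l₂)
    (by rw [← List.append_assoc, List.take_append_drop, hown])
    (fun sn hsn => hl₁ sn (List.mem_of_mem_take hsn)) (by rw [hlen]; exact Dvd.intro _ rfl) n hu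
  omega

end StableEpoch

/-! ### Certified sequence numbers -/

variable (E) in
/-- A correct replica eventually holds a commit-certificate of epoch `e` for `sn` and `x`. -/
def Certified (e sn : ℕ) (x : Option (Request Client Op)) : Prop :=
  ∃ i, ∃ w ∉ byz, (⟨e, sn, x⟩ : Entry Client Op) ∈ (E.state i w).certs

variable {e sn i : ℕ} {x : Option (Request Client Op)} {u v : P.Rep}

theorem Certified.exists_accepted (hbyz : byz.card ≤ P.f) (h : E.Certified e sn x) (hv : v ∉ byz)
    (hsn : sn ∈ (E.config e).own v) :
    ∃ j, E.InEpoch e j v ∧ (E.state j v).accepted sn = some x := by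
  obtain ⟨i, w, -, hx⟩ := h
  obtain ⟨j, -, hj⟩ := accepted_of_supported hbyz hv hsn (supported_of_mem_certs hx)
  exact ⟨j, hj⟩

theorem exists_proposed_of_accepted (hbyz : byz.card ≤ P.f) (hu : u ∉ byz) (hv : v ∉ byz)
    (hsn : sn ∈ (E.config e).own v) (hhang : (E.config e).hang sn = none) (h : E.InEpoch e i u)
    (hx : (E.state i u).accepted sn = some x) :
    ∃ r, x = some r ∧ ∃ j, E.InEpoch e j v ∧ (E.state j v).proposed sn = some r := by
  have hcfg := h.cfg_eq_config hbyz hu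
  rcases (E.inv i u).of_accepted h.active sn x hx with hx | ⟨w, hw, hg⟩
  · rw [hcfg, hhang] at hx
    exact absurd hx.symm (Option.some_ne_none x)
  · rw [hcfg] at hw
    obtain rfl := (E.config_sound e).own_unique hw hsn
    obtain ⟨j, -, hs⟩ := E.sends_of_got hv hg
    obtain ⟨ha, he, r, hr, hp⟩ := hs.prePrepare_inv
    exact ⟨r, hr, j, ⟨ha, he.symm.trans h.epoch_eq⟩, hp⟩

theorem Certified.exists_proposes (hbyz : byz.card ≤ P.f) (h : E.Certified e sn x) (hv : v ∉ byz)
    (hsn : sn ∈ (E.config e).own v) (hhang : (E.config e).hang sn = none) :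
    ∃ r, x = some r ∧ ∃ j, E.InEpoch e j v ∧ (E.state j v).Proposes v sn r := by
  obtain ⟨i, hi, hacc⟩ := h.exists_accepted hbyz hv hsn
  obtain ⟨r, hr, j, hj, hp⟩ := exists_proposed_of_accepted hbyz hv hv hsn hhang hi hacc
  obtain ⟨k, -, hk, hp⟩ := E.exists_proposes hp
  exact ⟨r, hr, k, ⟨hp.active, hk.trans hj.epoch_eq⟩, hp⟩

theorem proposed_unique {j : ℕ} {r r' : Request Client Op} (hi : E.InEpoch e i u)
    (hj : E.InEpoch e j u) (h : (E.state i u).proposed sn = some r)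
    (h' : (E.state j u).proposed sn = some r') : r = r' := by
  rcases E.sameEpoch_total (hi.epoch_eq.trans hj.epoch_eq.symm) with hs | hs
  · exact Option.some.inj ((hs.proposed hi.active sn r h).symm.trans h')
  · exact Option.some.inj (h.symm.trans (hs.proposed hj.active sn r' h'))

theorem exists_certified_of_lt_low (hbyz : byz.card ≤ P.f) {l₁ l₂ : List ℕ}
    (hown : (E.config e).own v = l₁ ++ sn :: l₂) (he : (E.state i u).epoch = e)
    (hlow : l₁.length < (E.state i u).low v) : ∃ x, E.Certified e sn x := by
  obtain ⟨c, hc, hlt⟩ := Finset.lt_sup_iff.1 hlow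
  obtain ⟨hstable, hce, rfl⟩ := Finset.mem_filter.1 hc
  obtain ⟨w, hw, j, -, z, hs⟩ := (supported_of_mem_stable hstable).exists_sends hbyz
  obtain ⟨ha, he', hlog⟩ := hs.checkpoint_inv
  have hj : E.InEpoch e j w := ⟨ha, he'.symm.trans (hce.trans he)⟩
  rw [hj.cfg_eq_config hbyz hw, hj.epoch_eq] at hlog
  have hlen : l₁.length < ((E.config e).own c.leader |>.take c.log.length).length := by
    rwa [hlog.length_eq]
  have hmem := (List.forall₂_iff_get.1 hlog).2 _ hlen hlt
  simp only [hown, List.get_eq_getElem, List.getElem_take, List.getElem_append_right le_rfl,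
    Nat.sub_self, List.getElem_cons_zero] at hmem
  exact ⟨_, j, w, hw, hmem.2⟩

/-! ### Success of an epoch with a correct primary -/

namespace StableEpoch

variable {J : ℕ → ℕ} {l₁ l₂ : List ℕ} {r : Request Client Op}

theorem exists_certified_of_proposed (h : E.StableEpoch e J) (hbyz : byz.card ≤ P.f)
    (hk : 1 ≤ P.k) (hv : v ∉ byz) (hfresh : (E.config e).FirstFresh v l₁ sn l₂)
    (hp : (E.state (J 12) v).proposed sn = some r) : ∃ x, E.Certified e sn x := by
  have hv12 := h.inEpoch hbyz 12 hv
  have hsn : sn ∈ (E.config e).own v := hfresh.own_eq ▸ List.mem_append_cons_self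
  by_cases! hlow : ∃ u, u ∉ byz ∧ l₁.length < (E.state (J 13) u).low v
  · obtain ⟨u, hu, hlow⟩ := hlow
    exact exists_certified_of_lt_low hbyz hfresh.own_eq (h.epoch_eq 13 hu) hlow
  have hbucket : (E.config e).bucket (P.hash r.client) = v := by
    obtain ⟨j, -, he, hpr⟩ := E.exists_proposes hp
    rw [← InEpoch.cfg_eq_config hbyz hv ⟨hpr.active, he.trans hv12.epoch_eq⟩]
    exact hpr.eligible.1
  have hacc : ∀ u ∉ byz, (E.state (J 13) u).accepted sn = some (some r) := by
    intro u hu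
    have hu13 := h.inEpoch hbyz 13 hu
    have hcfg := h.cfg_eq hbyz 13 hu
    have hg := h.got 12 hv hu (.prePrepare u sn r hv12.active hp)
    rw [hv12.epoch_eq] at hg
    rcases hc : (E.state (J 13) u).accepted sn with _ | x
    · obtain ⟨t, ht⟩ := h.quiet 13 hu
      exact absurd (.acceptPrePrepare v ⟨e, sn, some r⟩ r l₁ l₂ hu13.active hg hu13.epoch_eq.symm
        hc (hcfg ▸ hfresh.own_eq) (hlow u hu)
        (h.lt_low_add hbyz hk hv hfresh.own_eq hfresh.hang_ne_none 13 hu) rfl (hcfg ▸ hbucket))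
        (ht _)
    · obtain ⟨r', rfl, j, hj, hr'⟩ :=
        exists_proposed_of_accepted hbyz hu hv hsn hfresh.hang_eq_none hu13 hc
      rw [proposed_unique hj hv12 hr' hp]
  exact ⟨_, _, v, hv, h.mem_certs_of_accepted hbyz hv hsn 13 hacc hv⟩

theorem not_eligible_of_not_used (h : E.StableEpoch e J) (hbyz : byz.card ≤ P.f)
    (hk : 1 ≤ P.k) (hv : v ∉ byz) (hfresh : (E.config e).FirstFresh v l₁ sn l₂)
    (hsn : ¬ (E.state (J 12) v).Used sn) (hr : r ∈ (E.state (J 12) v).queue) :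
    ¬ (E.state (J 12) v).Eligible v r := by
  intro hel
  obtain ⟨r', hr'⟩ := Option.isSome_iff_exists.1 (List.find?_isSome
    (p := fun r => decide ((E.state (J 12) v).Eligible v r)) |>.2 ⟨r, hr, decide_eq_true hel⟩)
  obtain ⟨hel', q₁, q₂, hq, hq₁⟩ := List.find?_eq_some_iff_append.1 hr'
  have hcfg := h.cfg_eq hbyz 12 hv
  obtain ⟨t, ht⟩ := h.quiet 12 hv
  exact ht _ (.propose sn r' l₁ l₂ q₁ q₂ (h.inEpoch hbyz 12 hv).active (hcfg ▸ hfresh.own_eq)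
    (fun x hx => Or.inl (hcfg ▸ hfresh.hang_ne_none x hx)) hsn
    (h.lt_low_add hbyz hk hv hfresh.own_eq hfresh.hang_ne_none 12 hv) hq
    (fun x hx => by simpa using hq₁ x hx) (of_decide_eq_true hel'))

end StableEpoch

variable (E) in
/-- In epoch `e`, every correct leader commits its hanging sequence numbers, and its first fresh one
unless at some moment it could use that number but has nothing to propose. -/
structure Success (e : ℕ) : Prop where
  entered : ∀ {u}, u ∉ byz → ∃ i, E.InEpoch e i u
  hang : ∀ {v sn}, v ∉ byz → sn ∈ (E.config e).own v → (E.config e).hang sn ≠ none →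
    ∃ x, E.Certified e sn x
  fresh : ∀ {v l₁ sn l₂}, v ∉ byz → (E.config e).FirstFresh v l₁ sn l₂ →
    (∃ x, E.Certified e sn x) ∨ ∃ i, E.InEpoch e i v ∧ ¬ (E.state i v).Used sn ∧
      ∀ r ∈ (E.state i v).queue, ¬ (E.state i v).Eligible v r

theorem success_of_finished (hbyz : byz.card ≤ P.f) {w : P.Rep} (hw : w ∉ byz)
    (h : E.InEpoch e i w) (hfin : ∀ v, (E.state i w).Finished v) : E.Success e := by
  have hcert : ∀ {v sn}, sn ∈ (E.config e).own v → ∃ x, E.Certified e sn x := by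
    intro v sn hsn
    rw [← h.cfg_eq_config hbyz hw] at hsn
    obtain ⟨x, hx⟩ := hfin v sn hsn
    exact ⟨x, i, w, hw, h.epoch_eq ▸ hx⟩
  have own_of_firstFresh : ∀ {v l₁ sn l₂}, (E.config e).FirstFresh v l₁ sn l₂ →
      sn ∈ (E.config e).own v := fun hfresh => hfresh.own_eq ▸ List.mem_append_cons_self
  refine ⟨fun {u} hu => ?_, fun _ hsn _ => hcert hsn,
    fun _ hfresh => Or.inl (hcert (own_of_firstFresh hfresh))⟩
  obtain ⟨l₁, sn, l₂, hfresh⟩ := (E.config_sound e).exists_firstFresh u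
  obtain ⟨x, hx⟩ := hcert (own_of_firstFresh hfresh)
  obtain ⟨j, hj, -⟩ := hx.exists_accepted hbyz hu (own_of_firstFresh hfresh)
  exact ⟨j, hj⟩

theorem StableEpoch.success {J : ℕ → ℕ} (h : E.StableEpoch e J) (hbyz : byz.card ≤ P.f)
    (hk : 1 ≤ P.k) : E.Success e where
  entered hu := ⟨J 6, h.inEpoch hbyz 6 hu⟩
  hang {v sn} hv hsn hx := by
    obtain ⟨x, hx⟩ := Option.ne_none_iff_exists'.1 hx
    exact ⟨x, _, v, hv, h.mem_certs_of_hang hbyz hv hsn hx hv⟩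
  fresh {v l₁ sn l₂} hv hfresh := by
    by_cases hused : (E.state (J 12) v).Used sn
    · left
      have hp : (E.state (J 12) v).proposed sn ≠ none :=
        hused.resolve_left (not_not.2 (h.cfg_eq hbyz 12 hv ▸ hfresh.hang_eq_none))
      obtain ⟨r, hr⟩ := Option.ne_none_iff_exists'.1 hp
      exact h.exists_certified_of_proposed hbyz hk hv hfresh hr
    · exact Or.inr ⟨J 12, h.inEpoch hbyz 12 hv, hused,
        fun r => h.not_eligible_of_not_used hbyz hk hv hfresh hused⟩

theorem success (hP : P.WellFormed) (hT : P.TimersLast (18 * P.Δ)) (hbyz : byz.card ≤ P.f)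
    (he : 2 ≤ e) (hp : P.primary e ∉ byz) {N : ℕ} (hN : E.Reached e N)
    (hmin : ∀ i, E.Reached e i → N ≤ i) (hG : E.GST ≤ E.time N) : E.Success e := by
  have hΔ := hP.delta_pos
  have hN0 := E.time_nonneg N
  set J : ℕ → ℕ := fun n => E.indexAt (E.time N + n * P.Δ)
  by_cases! hstay : ∀ u ∉ byz, (E.state (J 17) u).epoch ≤ e
  · have hreached : E.Reached e (J 0) := hN.mono le_rfl fun w hw =>
      ⟨hw.1, hw.2.trans (E.epoch_mono (le_indexAt (by simp)) w)⟩
    have hJ : E.StableEpoch e J :=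
      { synchronous_indexAt hN0 hG hΔ.le with
        two_le := he, reached := hreached, stay := hstay, primary := hp }
    exact hJ.success hbyz hP.k_pos
  · obtain ⟨u, hu, hgt⟩ := hstay
    have htime : E.time (J 17) < E.time N + 18 * P.Δ :=
      (time_indexAt_le (by positivity)).trans_lt (by push_cast; linarith)
    obtain ⟨i, w, hw, hi, hfin⟩ :=
      exists_finished hbyz he hmin hΔ.le (by positivity) hT htime hu hgt
    exact success_of_finished hbyz hw hi hfin

theorem eventually_le_of_reached (hbyz : byz.card ≤ P.f) (N : ℕ) :
    ∀ᶠ e in Filter.atTop, ∀ i, E.Reached e i → N ≤ i := by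
  filter_upwards [Filter.eventually_gt_atTop (Finset.univ.sup fun u => (E.state N u).epoch)]
    with e he i hi
  by_contra! hlt
  obtain ⟨w, -, hw⟩ := AtLeast.exists_correct hbyz hi le_rfl
  have hle := hw.2.trans (E.epoch_mono hlt.le w)
  exact (hle.trans (Finset.le_sup (f := fun u => (E.state N u).epoch) (Finset.mem_univ w))).not_gt
    he

theorem eventually_success (hP : P.WellFormed) (hT : P.TimersLast (18 * P.Δ))
    (hbyz : byz.card ≤ P.f) : ∀ᶠ e in Filter.atTop, P.primary e ∉ byz → E.Success e := by
  obtain ⟨N, hN⟩ := (E.time_unbounded.eventually_ge_atTop E.GST).exists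
  filter_upwards [Filter.eventually_ge_atTop 2, eventually_le_of_reached (E := E) hbyz N]
    with e he hlate hp
  have hex : ∃ i, E.Reached e i := by
    obtain ⟨i, hi⟩ := (eventually_le_epoch (E := E) hbyz e).exists
    exact ⟨i, atLeast_of_correct hbyz (by omega) fun w hw => ⟨hw, hi w hw⟩⟩
  exact success hP hT hbyz he hp (Nat.find_spec hex) (fun i hi => Nat.find_min' hex hi)
    (hN.trans (E.time_mono (hlate _ (Nat.find_spec hex))))

variable {r : Request Client Op}

/-! ### Dissemination of commit-certificates -/

theorem frequently_inEpoch (hP : P.WellFormed) (hT : P.TimersLast (18 * P.Δ))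
    (hbyz : byz.card ≤ P.f) (hu : u ∉ byz) : ∃ᶠ e in Filter.atTop, ∃ i, E.InEpoch e i u := by
  have hprimary : ∃ᶠ e in Filter.atTop, P.primary e = u :=
    primaryOf_frequently P.f P.g P.perf hP.window u
  refine (hprimary.and_eventually (eventually_success (E := E) hP hT hbyz)).mono ?_
  exact fun e ⟨hp, hs⟩ => (hs (hp ▸ hu)).entered hu

/-- A replica that enters an epoch after `w` has stored a certificate fetches it from `w`. -/
theorem exists_mem_certs {w : P.Rep} (hu : u ∉ byz) (hw : w ∉ byz)
    (hent : ∃ᶠ e in Filter.atTop, ∃ k, E.InEpoch e k u) {d : Entry Client Op}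
    (hd : d ∈ (E.state i w).certs) : ∃ j, d ∈ (E.state j u).certs := by
  obtain ⟨e, he, k, hk⟩ := Filter.frequently_atTop.1 hent ((E.state i u).epoch + 2)
  obtain ⟨l, hl, -⟩ := E.network k u w _ hu hw
    (.fetch w hk.active (hk.epoch_eq ▸ (Nat.le_add_left 2 _).trans he))
  have hil : i ≤ l := by
    obtain ⟨j, hjl, hs⟩ := E.authentic l u w _ hl hu
    by_contra! hli
    have hj := hs.fetch_inv
    have hji := E.epoch_mono (hjl.trans hli.le) u
    have := hk.epoch_eq
    omega
  have hsupply : (u, (E.state l w).certs) ∈ (E.state (l + 1) w).supplied := by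
    rw [(E.on_deliver l _ _ _ hl).1]
    exact Finset.mem_insert_self _ _
  obtain ⟨j, hj⟩ := (eventually_got_of_sends hw hu (.supply u _ hsupply)).exists
  exact ⟨j, (E.inv j u).supply _ _ hj ((E.evolves hil w).certs hd)⟩

theorem Certified.exists_hasCommitted (hP : P.WellFormed) (hT : P.TimersLast (18 * P.Δ))
    (hbyz : byz.card ≤ P.f) (hu : u ∉ byz) (h : E.Certified e sn (some r)) :
    ∃ j, (E.state j u).HasCommitted r := by
  obtain ⟨i, w, hw, hd⟩ := h
  obtain ⟨j, hj⟩ := exists_mem_certs hu hw (frequently_inEpoch hP hT hbyz hu) hd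
  exact ⟨j, _, hj, rfl⟩

theorem hasCommitted_mono {j : ℕ} (hij : i ≤ j) (h : (E.state i u).HasCommitted r) :
    (E.state j u).HasCommitted r := by
  obtain ⟨d, hd, hr⟩ := h
  exact ⟨d, (E.evolves hij u).certs hd, hr⟩

/-! ### Liveness -/

/-- Each leader serves each bucket infinitely often under each of `f+1` primaries, one of which is
correct. -/
theorem frequently_success_and_bucket_eq (hP : P.WellFormed) (hT : P.TimersLast (18 * P.Δ))
    (hbyz : byz.card ≤ P.f) (v : P.Rep) (b : Fin (P.m * (3 * P.f + 1))) :
    ∃ᶠ e in Filter.atTop, E.Success e ∧ (E.config e).bucket b = v := by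
  obtain ⟨S, hS, hfreq⟩ := hP.rotation.rotates (fun e => (E.config e).load)
    (fun e w => hP.Cmin_pos.trans ((E.config_sound e).Cmin_le_load w)) v b
  obtain ⟨p, hpS, hp⟩ := exists_correct hbyz hS
  refine ((hfreq p hpS).and_eventually (eventually_success (E := E) hP hT hbyz)).mono ?_
  rintro e ⟨⟨hpe, hrot⟩, hs⟩
  exact ⟨hs (hpe ▸ hp), (congrFun (E.config_sound e).bucket_eq b).trans hrot⟩

theorem eventually_forall_inEpoch {p : ℕ → Prop} (hp : ∀ᶠ n in Filter.atTop, p n) (u : P.Rep) :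
    ∀ᶠ e in Filter.atTop, ∀ n, E.InEpoch e n u → p n := by
  obtain ⟨N, hN⟩ := Filter.eventually_atTop.1 hp
  filter_upwards [Filter.eventually_gt_atTop (E.state N u).epoch] with e he n hn
  refine hN n (le_of_not_gt fun hlt => ?_)
  exact ((hn.epoch_eq ▸ E.epoch_mono hlt.le u).trans_lt he).false

theorem exists_settled_prefix (hr : r ∈ (E.state i u).queue) :
    ∃ q₁, ∀ᶠ n in Filter.atTop, (∃ q₂, (E.state n u).queue = q₁ ++ r :: q₂) ∧
      ∀ r' ∈ q₁, ∀ j, (E.state j u).HasCommitted r' → (E.state n u).HasCommitted r' := by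
  obtain ⟨q₁, q₂, hq⟩ := List.append_of_mem hr
  refine ⟨q₁, .and ?_ ((Filter.eventually_all_finite q₁.finite_toSet).2 fun r' _ => ?_)⟩
  · filter_upwards [Filter.eventually_ge_atTop i] with n hn
    obtain ⟨l, hl⟩ := (E.evolves hn u).queue
    exact ⟨q₂ ++ l, by rw [← hl, hq, List.append_assoc, List.cons_append]⟩
  · by_cases! h : ∃ j, (E.state j u).HasCommitted r'
    · obtain ⟨j, hj⟩ := h
      filter_upwards [Filter.eventually_ge_atTop j] with n hn _ _
      exact hasCommitted_mono hn hj
    · exact .of_forall fun n j hj => absurd hj (h j)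

theorem mem_of_append_cons_eq {α : Type*} {a b c d : List α} {x y : α}
    (h : a ++ x :: b = c ++ y :: d) : x ∈ c ∨ x = y ∨ y ∈ a := by
  rcases List.append_eq_append_iff.1 h with ⟨_ | ⟨z, l⟩, rfl, hl⟩ | ⟨_ | ⟨z, l⟩, rfl, hl⟩ <;>
    simp only [List.cons_append, List.nil_append, List.cons.injEq] at hl <;> simp [hl.1]

theorem Success.hang_ne (hbyz : byz.card ≤ P.f) (hs : E.Success e) (hv : v ∉ byz)
    (hbucket : (E.config e).bucket (P.hash r.client) = v)
    (hno : ∀ sn, ¬ E.Certified e sn (some r)) (sn : ℕ) :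
    (E.config e).hang sn ≠ some (some r) := by
  intro hsn
  have hown := hbucket ▸ (E.config_sound e).mem_own_of_hang hsn
  obtain ⟨x, hx⟩ := hs.hang hv hown (hsn ▸ Option.some_ne_none _)
  obtain ⟨j, hj, hacc⟩ := hx.exists_accepted hbyz hv hown
  have hacc' := (E.inv j v).accepted_of_hang hj.active sn _ (hj.cfg_eq_config hbyz hv ▸ hsn)
  obtain rfl := Option.some.inj (hacc.symm.trans hacc')
  exact hno sn hx

/-- While a leader has not used its first fresh sequence number, it has proposed nothing. -/
theorem eligible_of_not_used (hbyz : byz.card ≤ P.f) (hv : v ∉ byz) {l₁ l₂ : List ℕ}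
    (hfresh : (E.config e).FirstFresh v l₁ sn l₂)
    (hbucket : (E.config e).bucket (P.hash r.client) = v)
    (hhang : ∀ x, (E.config e).hang x ≠ some (some r)) (h : E.InEpoch e i v)
    (hsn : ¬ (E.state i v).Used sn) (hcom : ¬ (E.state i v).HasCommitted r) :
    (E.state i v).Eligible v r := by
  have hcfg := h.cfg_eq_config hbyz hv
  refine ⟨hcfg ▸ hbucket, hcom, hcfg ▸ hhang, fun x hx => ?_⟩
  obtain ⟨l₁', l₂', hown, hused, hnone⟩ :=
    (E.inv i v).of_proposed h.active x (hx ▸ Option.some_ne_none r)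
  rw [hcfg] at hown hnone
  rcases mem_of_append_cons_eq (hown.symm.trans hfresh.own_eq) with hmem | rfl | hmem
  · exact hfresh.hang_ne_none x hmem hnone
  · exact hsn (Or.inr (hx ▸ Option.some_ne_none r))
  · exact hsn (hused sn hmem)

/-- Consider a successful epoch in which `v` serves the bucket of `r`, so late that every request
before `r` in the queue of `v` that is ever committed has been committed. Then the request that `v`
proposes first is `r`. -/
theorem exists_hasCommitted_of_mem_queue (hP : P.WellFormed) (hT : P.TimersLast (18 * P.Δ))
    (hbyz : byz.card ≤ P.f) (hv : v ∉ byz) (hr : r ∈ (E.state i v).queue) :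
    ∃ j, (E.state j v).HasCommitted r := by
  by_contra! hno
  obtain ⟨q₁, hq₁⟩ := exists_settled_prefix hr
  obtain ⟨e, ⟨hs, hbucket⟩, hlate⟩ := (frequently_success_and_bucket_eq hP hT hbyz v
    (P.hash r.client)).and_eventually (eventually_forall_inEpoch hq₁ v) |>.exists
  obtain ⟨l₁, sn, l₂, hfresh⟩ := (E.config_sound e).exists_firstFresh v
  have hcertified : ∀ sn, ¬ E.Certified e sn (some r) := fun sn h => by
    obtain ⟨j, hj⟩ := h.exists_hasCommitted hP hT hbyz hv
    exact hno j hj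
  have heligible : ∀ j, E.InEpoch e j v → ¬ (E.state j v).Used sn → (E.state j v).Eligible v r :=
    fun j hj hsn => eligible_of_not_used hbyz hv hfresh hbucket
      (hs.hang_ne hbyz hv hbucket hcertified) hj hsn (hno j)
  rcases hs.fresh hv hfresh with ⟨x, hx⟩ | ⟨j, hj, hsn, hnone⟩
  · have hown : sn ∈ (E.config e).own v := hfresh.own_eq ▸ List.mem_append_cons_self
    obtain ⟨r', rfl, j, hj, hprop⟩ := hx.exists_proposes hbyz hv hown hfresh.hang_eq_none
    obtain ⟨⟨q₂, hq⟩, hsettled⟩ := hlate j hj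
    obtain ⟨q₁', q₂', hq', hfirst⟩ := hprop.first
    rcases mem_of_append_cons_eq (hq'.symm.trans hq) with hmem | rfl | hmem
    · obtain ⟨k, hk⟩ := hx.exists_hasCommitted hP hT hbyz hv
      exact hprop.eligible.2.1 (hsettled r' hmem k hk)
    · exact hcertified sn hx
    · exact hfirst r hmem (heligible j hj hprop.fresh)
  · obtain ⟨⟨q₂, hq⟩, -⟩ := hlate j hj
    exact hnone r (hq ▸ List.mem_append_cons_self) (heligible j hj hsn)

theorem exists_hasCommitted_of_submit (hP : P.WellFormed) (hT : P.TimersLast (18 * P.Δ))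
    (hbyz : byz.card ≤ P.f) (hsub : E.event i = .submit r) (hr : r.client ∈ good) (hu : u ∉ byz) :
    ∃ j, (E.state j u).HasCommitted r := by
  obtain ⟨k, -, hdeliver, -⟩ := E.client_network i r u hsub hr hu
  exact exists_hasCommitted_of_mem_queue hP hT hbyz hu
    ((E.inv (k + 1) u).request _ _ (E.mem_inbox_of_deliver k.lt_succ_self hdeliver))

end Execution

end

end FnF

theorem mainTheorem2 :
    ∃ κ : ℝ, 0 < κ ∧
      ∀ (Client Op : Type*) (P : FnF.Protocol Client), P.WellFormed →
        κ * P.Δ ≤ P.Te → κ * P.Δ ≤ P.T → κ * P.Δ ≤ P.Tp →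
        ∀ (byz : Finset P.Rep), byz.card ≤ P.f →
        ∀ (good : Set Client) (E : FnF.Execution P Op byz good)
          (i : ℕ) (r : FnF.Request Client Op), E.event i = .submit r → r.client ∈ good →
        ∀ u ∉ byz, ∃ j, ∀ j' ≥ j, (E.state j' u).HasCommitted r := by
  refine ⟨18, by norm_num, fun Client Op P hP hTe hT hTp byz hbyz good E i r hsub hr u hu => ?_⟩
  obtain ⟨j, hj⟩ := FnF.Execution.exists_hasCommitted_of_submit hP ⟨hTe, hT, hTp⟩ hbyz hsub hr hu
  exact ⟨j, fun j' hj' => FnF.Execution.hasCommitted_mono hj' hj⟩
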